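/- **Theorem 2.3 (Eigenvalue equation).** Let $N\ge 1$ and let $u(x)=\sum_{k=-N}^{N}c_ke^{ikx}$ be a real-valued trigonometric polynomial on $\mathbb T=\mathbb R/2\pi\mathbb Z$ with zero mean and with $c_N>0$. (Any real zero-mean trigonometric polynomial of order exactly $N$ can be brought to this form by a translation in $x$.) Let $\varepsilon>0$ and $\lambda\in\mathbb R$. Let $L^2_+(\mathbb T)$ be the Hardy space of the $h\in L^2(\mathbb T)$ with only nonnegative Fourier modes, let $\Pi$ be the orthogonal projector of $L^2(\mathbb T)$ onto $L^2_+(\mathbb T)$, and let $L_u(\varepsilon)$ be the unbounded operator on $L^2_+(\mathbb T)$ with domain $H^1_+(\mathbb T)=\{h\in L^2_+(\mathbb T): \partial_xh\in L^2(\mathbb T)\}$ given by $$L_u(\varepsilon)h=-i\varepsilon\,\partial_xh-\Pi(uh).$$ Put $\theta_k=\frac{(2k-1)\pi}{N}$ and $$Q(z)=\sum_{k=1}^N\Big(-c_k\frac{z^k}{k}+\overline{c_k}\,\frac{z^{-k}}{k}\Big),\qquad z\in\mathbb C\setminus\{0\}.$$ For $1\le k\le N-1$ let $\Gamma_k$ be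 the closed contour made of the segment $[0,e^{i\theta_k}]$, the arc of the unit circle on which the argument increases from $\theta_k$ to $\theta_{k+1}$, and the segment $[e^{i\theta_{k+1}},0]$. Let $\Gamma_N^-$ be the segment $[0,e^{i\theta_N}]$ followed by the arc of the unit circle from argument $\theta_N$ to $2\pi$, and let $\Gamma_N^+$ be the arc of the unit circle from argument $0$ to $\theta_1$ followed by the segment $[e^{i\theta_1},0]$. Powers $\zeta^s$ are taken on $\mathbb C\setminus[0,+\infty)$ with the determination $\arg\zeta\in(0,2\pi)$. For $1\le\ell\le N$ define $$A_{k,\ell}=\int_{\Gamma_k}e^{Q(\zeta)/\varepsilon}\zeta^{-\ell-\lambda/\varepsilon}\frac{d\zeta}{\zeta}\quad(1\le k\le N-1),\qquad A_{N,\ell}^{\pm}=\int_{\Gamma_N^{\pm}}e^{Q(\zeta)/\varepsilon}\zeta^{-\ell-\lambda/\varepsilon}\frac{d\zeta}{\zeta},$$ $$A_{N,\ell}=A_{N,\ell}^{+}+e^{2i\pi\lambda/\varepsilon}A_{N,\ell}^{-},$$ and let $A(\lambda;\varepsilon)=(A_{k,\ell})_{1\le k,\ell\le N}$. Then all these integrals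 converge absolutely, and $\lambda$ is an eigenvalue of $L_u(\varepsilon)$ if and only if $$\det A(\lambda;\varepsilon)=0.$$ -/

import Mathlib

open MeasureTheory AddCircle
open scoped Real ComplexConjugate

namespace LaxEvans

noncomputable section

/-! ### The Lax operator on the Hardy space of the torus -/

instance factTwoPiPos : Fact ((0 : ℝ) < 2 * π) := ⟨Real.two_pi_pos⟩

/-- The torus `ℝ / 2πℤ`. -/
abbrev Torus : Type := AddCircle (2 * π)

/-- `L²(𝕋)`, with the normalised Lebesgue measure. -/
abbrev L2 : Type := Lp ℂ 2 (haarAddCircle : Measure Torus)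

/-- The Hardy space `L²₊(𝕋)`: only nonnegative Fourier modes. -/
def hardySpace : Submodule ℂ L2 where
  carrier := {f | ∀ n : ℤ, n < 0 → fourierCoeff f n = 0}
  zero_mem' := by
    intro n _
    rw [← fourierBasis_repr]; simp
  add_mem' := by
    intro f g hf hg n hn
    have h1 := hf n hn
    have h2 := hg n hn
    rw [← fourierBasis_repr] at h1 h2 ⊢
    simp [h1, h2]
  smul_mem' := by
    intro a f hf n hn
    have h1 := hf n hn
    rw [← fourierBasis_repr] at h1 ⊢
    simp [h1]

theorem mem_hardySpace {f : L2} :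
    f ∈ hardySpace ↔ ∀ n : ℤ, n < 0 → fourierCoeff f n = 0 := Iff.rfl

theorem isClosed_hardySpace : IsClosed (hardySpace : Set L2) := by
  have h : (hardySpace : Set L2) =
      ⋂ (n : ℤ) (_ : n < 0), {f : L2 | inner ℂ (fourierBasis (T := 2 * π) n) f = 0} := by
    ext f
    simp only [SetLike.mem_coe, mem_hardySpace, Set.mem_iInter, Set.mem_ofPred_eq,
      ← fourierBasis_repr, HilbertBasis.repr_apply_apply]
  rw [h]
  refine isClosed_iInter fun n => isClosed_iInter fun _ => ?_
  exact isClosed_eq (continuous_const.inner continuous_id) continuous_const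

instance completeSpace_hardySpace : CompleteSpace hardySpace :=
  isClosed_hardySpace.completeSpace_coe

/-- The Szegő projector: the orthogonal projection of `L²(𝕋)` onto `L²₊(𝕋)`. -/
def szego : L2 →L[ℂ] hardySpace := hardySpace.orthogonalProjectionOnto

theorem memLp_mul (u : C(Torus, ℝ)) (f : L2) :
    MemLp (fun x => (u x : ℂ) * f x) 2 (haarAddCircle : Measure Torus) := by
  obtain ⟨C, hC⟩ := isCompact_univ.exists_bound_of_continuousOn u.continuous.continuousOn
  refine (Lp.memLp f).of_le_mul (c := C) ?_ ?_
  · exact ((Complex.continuous_ofReal.comp u.continuous).aestronglyMeasurable).mul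
      (Lp.aestronglyMeasurable f)
  · refine Filter.Eventually.of_forall fun x => ?_
    rw [norm_mul, Complex.norm_real]
    exact mul_le_mul_of_nonneg_right (hC x (Set.mem_univ x)) (norm_nonneg _)

/-- Multiplication by the continuous real function `u` on `L²(𝕋)`. -/
def mulOp (u : C(Torus, ℝ)) : L2 →ₗ[ℂ] L2 where
  toFun f := (memLp_mul u f).toLp _
  map_add' f g := by
    rw [← MemLp.toLp_add]
    refine MemLp.toLp_congr _ _ ?_
    filter_upwards [Lp.coeFn_add f g] with x hx
    simp only [hx, Pi.add_apply]; ring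
  map_smul' a f := by
    rw [RingHom.id_apply, ← MemLp.toLp_const_smul]
    refine MemLp.toLp_congr _ _ ?_
    filter_upwards [Lp.coeFn_smul a f] with x hx
    simp only [hx, Pi.smul_apply, smul_eq_mul]; ring

/-- `g` is the (weak) derivative `∂ₓ f` of `f`. -/
def IsDeriv (f g : hardySpace) : Prop :=
  ∀ n : ℤ, fourierCoeff (g : L2) n = Complex.I * n * fourierCoeff (f : L2) n

theorem IsDeriv.unique {f g g' : hardySpace} (h : IsDeriv f g) (h' : IsDeriv f g') : g = g' := by
  apply Subtype.ext
  apply (fourierBasis (T := 2 * π)).repr.injective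
  ext n
  rw [fourierBasis_repr, fourierBasis_repr, h n, h' n]

theorem IsDeriv.add {f f' g g' : hardySpace} (h : IsDeriv f g) (h' : IsDeriv f' g') :
    IsDeriv (f + f') (g + g') := by
  intro n
  have h1 := h n
  have h2 := h' n
  simp only [← fourierBasis_repr] at h1 h2 ⊢
  simp only [Submodule.coe_add, map_add, lp.coeFn_add, Pi.add_apply, h1, h2]
  ring

theorem IsDeriv.smul {f g : hardySpace} (a : ℂ) (h : IsDeriv f g) :
    IsDeriv (a • f) (a • g) := by
  intro n
  have h1 := h n
  simp only [← fourierBasis_repr] at h1 ⊢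
  simp only [Submodule.coe_smul, map_smul, lp.coeFn_smul, Pi.smul_apply, smul_eq_mul, h1]
  ring

theorem IsDeriv.zero : IsDeriv 0 0 := by
  intro n
  simp only [← fourierBasis_repr]
  simp

/-- `H¹₊(𝕋)`, the elements of the Hardy space whose derivative is in `L²(𝕋)`. -/
def hardySobolev : Submodule ℂ hardySpace where
  carrier := {f | ∃ g, IsDeriv f g}
  zero_mem' := ⟨0, IsDeriv.zero⟩
  add_mem' := by
    rintro f f' ⟨g, hg⟩ ⟨g', hg'⟩
    exact ⟨g + g', hg.add hg'⟩
  smul_mem' := by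
    rintro a f ⟨g, hg⟩
    exact ⟨a • g, hg.smul a⟩

/-- The derivative `∂ₓ : H¹₊ → L²₊`. -/
def derivOp : hardySobolev →ₗ[ℂ] hardySpace where
  toFun f := f.2.choose
  map_add' f f' := (f + f').2.choose_spec.unique (f.2.choose_spec.add f'.2.choose_spec)
  map_smul' a f := (a • f).2.choose_spec.unique (f.2.choose_spec.smul a)

theorem isDeriv_derivOp (f : hardySobolev) : IsDeriv (f : hardySpace) (derivOp f) :=
  f.2.choose_spec

/-- The Lax operator `L_u(ε) h = -iε ∂ₓ h - Π(u h)`, an unbounded operator on `L²₊(𝕋)` with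
domain `H¹₊(𝕋)`. -/
def laxOperator (u : C(Torus, ℝ)) (ε : ℝ) : hardySpace →ₗ.[ℂ] hardySpace where
  domain := hardySobolev
  toFun := (-(Complex.I * ε)) • derivOp -
    (szego.toLinearMap ∘ₗ mulOp u ∘ₗ hardySpace.subtype ∘ₗ hardySobolev.subtype)

/-- `lam` is an eigenvalue of the unbounded operator `T`. -/
def IsEigenvalue (T : hardySpace →ₗ.[ℂ] hardySpace) (lam : ℂ) : Prop :=
  ∃ f : T.domain, f ≠ 0 ∧ T f = lam • (f : hardySpace)

/-! ### The Evans function -/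

/-- The angles `θ_k = (2k - 1)π / N`. -/
def theta (N k : ℕ) : ℝ := (2 * (k : ℝ) - 1) * π / N

/-- The arc of the unit circle on which the argument varies from `α` to `β`
(note that `circleMap 0 1 t = e^{it}`). -/
def arc (α β : ℝ) : Path (circleMap 0 1 α) (circleMap 0 1 β) where
  toFun t := circleMap 0 1 (α + t * (β - α))
  continuous_toFun := (continuous_circleMap 0 1).comp (by fun_prop)
  source' := by simp
  target' := by simp

/-- The closed contour `Γ_k`: the segment `[0, e^{iθ_k}]`, the arc from `θ_k` to `θ_{k+1}`,
the segment `[e^{iθ_{k+1}}, 0]`. -/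
def Gam (N k : ℕ) : Path (0 : ℂ) 0 :=
  ((Path.segment 0 (circleMap 0 1 (theta N k))).trans (arc (theta N k) (theta N (k + 1)))).trans
    (Path.segment (circleMap 0 1 (theta N (k + 1))) 0)

/-- The contour `Γ_N^-`: the segment `[0, e^{iθ_N}]`, then the arc from `θ_N` to `2π`. -/
def GamMinus (N : ℕ) : Path (0 : ℂ) (circleMap 0 1 (2 * π)) :=
  (Path.segment 0 (circleMap 0 1 (theta N N))).trans (arc (theta N N) (2 * π))

/-- The contour `Γ_N^+`: the arc from `0` to `θ_1`, then the segment `[e^{iθ_1}, 0]`. -/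
def GamPlus (N : ℕ) : Path (circleMap 0 1 0) (0 : ℂ) :=
  (arc 0 (theta N 1)).trans (Path.segment (circleMap 0 1 (theta N 1)) 0)

/-- `Q(z) = ∑_{k=1}^N (-c_k z^k / k + \bar c_k z^{-k} / k)`. -/
def Q (N : ℕ) (c : ℤ → ℂ) (z : ℂ) : ℂ :=
  ∑ k ∈ Finset.Icc 1 N, (-(c k) * z ^ k / k + conj (c k) * (z ^ k)⁻¹ / k)

/-- The holomorphic logarithm on `ℂ ∖ [0, +∞)` with imaginary part (argument) in `(0, 2π)`. -/
def logCut (z : ℂ) : ℂ := Complex.log (-z) + π * Complex.I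

/-- The power `z ^ s` on `ℂ ∖ [0, +∞)` for the determination of the argument in `(0, 2π)`. -/
def powCut (z s : ℂ) : ℂ := Complex.exp (s * logCut z)

/-- The 1-form `e^{Q(ζ)/ε} ζ^{-ℓ-λ/ε} dζ / ζ`. -/
def form (N : ℕ) (c : ℤ → ℂ) (ε lam : ℝ) (l : ℕ) (ζ : ℂ) : ℂ →L[ℂ] ℂ :=
  (Complex.exp (Q N c ζ / ε) * powCut ζ (-(l : ℂ) - lam / ε) / ζ) • ContinuousLinearMap.id ℂ ℂ

/-- The coefficient `A_{k,ℓ}`, `1 ≤ k, ℓ ≤ N`. -/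
def coeffA (N : ℕ) (c : ℤ → ℂ) (ε lam : ℝ) (k l : ℕ) : ℂ :=
  if k < N then curveIntegral (form N c ε lam l) (Gam N k)
  else curveIntegral (form N c ε lam l) (GamPlus N) +
    Complex.exp (2 * π * Complex.I * lam / ε) * curveIntegral (form N c ε lam l) (GamMinus N)

/-- The matrix `A(λ; ε)`; rows and columns are numbered from `1` to `N`. -/
def matrixA (N : ℕ) (c : ℤ → ℂ) (ε lam : ℝ) : Matrix (Fin N) (Fin N) ℂ :=
  Matrix.of fun i j => coeffA N c ε lam (i + 1) (j + 1)

/-- All the integrals defining `A(λ; ε)` converge absolutely. -/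
def IntegralsConverge (N : ℕ) (c : ℤ → ℂ) (ε lam : ℝ) : Prop :=
  ∀ l ∈ Finset.Icc 1 N,
    (∀ k ∈ Finset.Ico 1 N, CurveIntegrable (form N c ε lam l) (Gam N k)) ∧
    CurveIntegrable (form N c ε lam l) (GamPlus N) ∧
    CurveIntegrable (form N c ε lam l) (GamMinus N)

end

end LaxEvans

namespace LaxEvans

noncomputable section

open Filter Topology

/-! ### The eigenvalue equation in terms of Fourier coefficients -/

/-! With `z = e^{ix}`, the Fourier series of an eigenvector is a function `h` holomorphic in the
disc, and `-i∂ₓ` becomes `z d/dz`. Only the frequencies `-N, …, -1` of `uh` are removed by the Szegő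
projector, so the eigenvalue equation reads `ε z h' = (u + λ) h - ∑ b_l z^{-l}` with `1 ≤ l ≤ N`. In
the coordinate `z = e^ξ` the factor `w = e^{Q/ε} z^{-λ/ε}` satisfies `w' = -(u + λ) w / ε`; hence `F
= -ε w h` is a primitive of `w ∑ b_l z^{-l}`, the combination of the integrands of `A` with
coefficients `b`.

Along the rays of argument `θ_k` the leading term of `Q` is negative and of order `|z|^{-N}`, so `w`
decays faster than any power of `|z|` at the origin. All the integrals therefore converge, and every
primitive of an integrand has a limit on each ray. Up to a nonzero factor per row, `A_{k,l}` is the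
difference of the limits on two consecutive rays (`coeffA_eq`); the last row closes up by the
monodromy of `w`. So `A b = 0` means that the primitive attached to `b` has the same limit on all
rays.

If `h` is an eigenvector, it is bounded near `0`, so `F` tends to `0` on every ray and `A b = 0`.
Moreover `b ≠ 0`, because otherwise the recurrence extends to negative frequencies and `c_{-N} ≠ 0`
kills all the coefficients of `h` (`IsEigenSeq.tailCoeff_ne_zero`).

Conversely, a kernel vector `b ≠ 0` gives, after subtraction of the common limit, an `F` that tends
to `0` on all rays. The additive part of its monodromy then vanishes, so `F / w` is single-valued in
`z ≠ 0`. The main point is that `F / w` is bounded near `0` (`IsAdmissible.exists_norm_quot_le`):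
near the origin every point can be reached along a line on which `|w|` increases quickly, from a
place where `F / w` or `F` is under control. The singularity is then removable, and the Laurent
coefficients of `F / w` form an eigenvector, nonzero because `b` is. -/

theorem fourierCoeff_fourier_mul (f : Torus → ℂ) (k n : ℤ) :
    fourierCoeff (fun x => fourier k x * f x) n = fourierCoeff f (n - k) := by
  unfold fourierCoeff
  congr 1
  ext x
  rw [show -(n - k) = -n + k by ring, fourier_add]
  simp only [smul_eq_mul]
  ring

theorem fourierCoeff_one (n : ℤ) :
    fourierCoeff (fun _ : Torus => (1 : ℂ)) n = if n = 0 then 1 else 0 := by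
  have h : fourierCoeff (fun _ : Torus => (1 : ℂ)) n =
      fourierCoeff (fourierLp 2 0 : L2) n := by
    apply congrFun
    apply fourierCoeff_congr_ae
    filter_upwards [coeFn_fourierLp (T := 2 * π) 2 0] with x hx
    rw [hx]; simp
  rw [h, ← fourierBasis_repr, ← coe_fourierBasis, HilbertBasis.repr_self]
  simp [lp.single_apply, Pi.single_apply]

theorem integrable_fourier_mul {f : Torus → ℂ} (hf : Integrable f haarAddCircle) (k : ℤ) :
    Integrable (fun x => fourier k x * f x) haarAddCircle := by
  simpa using hf.fourier_smul k

theorem fourierCoeff_trigPoly_mul (N : ℕ) (c : ℤ → ℂ) {f : Torus → ℂ}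
    (hf : Integrable f haarAddCircle) (n : ℤ) :
    fourierCoeff (fun x => (∑ k ∈ Finset.Icc (-(N : ℤ)) (N : ℤ), c k * fourier k x) * f x) n =
      ∑ k ∈ Finset.Icc (-(N : ℤ)) (N : ℤ), c k * fourierCoeff f (n - k) := by
  have h : (fun x => (∑ k ∈ Finset.Icc (-(N : ℤ)) (N : ℤ), c k * fourier k x) * f x) =
      ∑ k ∈ Finset.Icc (-(N : ℤ)) (N : ℤ), fun x : Torus => c k * (fourier k x * f x) := by
    ext x
    rw [Finset.sum_apply, Finset.sum_mul]
    exact Finset.sum_congr rfl fun k _ => by ring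
  rw [h, fourierCoeff.sum _ _ fun k _ => (integrable_fourier_mul hf k).const_mul (c k),
    Finset.sum_apply]
  refine Finset.sum_congr rfl fun k _ => ?_
  rw [fourierCoeff.const_mul, fourierCoeff_fourier_mul]

/-- The restriction on `n` matters: `c` is arbitrary outside `[-N, N]`. -/
theorem fourierCoeff_trigPoly {N : ℕ} {c : ℤ → ℂ} {u : C(Torus, ℝ)}
    (hu : ∀ x : Torus, (u x : ℂ) = ∑ k ∈ Finset.Icc (-(N : ℤ)) (N : ℤ), c k * fourier k x)
    {n : ℤ} (hn : n ∈ Finset.Icc (-(N : ℤ)) (N : ℤ)) :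
    fourierCoeff (fun x => (u x : ℂ)) n = c n := by
  have h := fourierCoeff_trigPoly_mul N c (f := fun _ => (1 : ℂ)) (integrable_const _) n
  simp only [mul_one, ← hu] at h
  rw [h, Finset.sum_eq_single_of_mem n hn]
  · simp [fourierCoeff_one]
  · intro k _ hk
    rw [fourierCoeff_one, if_neg (sub_ne_zero.2 hk.symm), mul_zero]

theorem conj_coeff {N : ℕ} {c : ℤ → ℂ} {u : C(Torus, ℝ)}
    (hu : ∀ x : Torus, (u x : ℂ) = ∑ k ∈ Finset.Icc (-(N : ℤ)) (N : ℤ), c k * fourier k x)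
    {n : ℤ} (hn : n ∈ Finset.Icc (-(N : ℤ)) (N : ℤ)) : c (-n) = conj (c n) := by
  have hn' : -n ∈ Finset.Icc (-(N : ℤ)) (N : ℤ) := by
    rw [Finset.mem_Icc] at hn ⊢; omega
  rw [← fourierCoeff_trigPoly hu hn, ← fourierCoeff_trigPoly hu hn']
  unfold fourierCoeff
  rw [← integral_conj]
  congr 1
  ext x
  simp only [smul_eq_mul, map_mul, Complex.conj_ofReal, fourier_neg, Complex.conj_conj, neg_neg]

theorem coeff_zero {N : ℕ} {c : ℤ → ℂ} {u : C(Torus, ℝ)}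
    (hu : ∀ x : Torus, (u x : ℂ) = ∑ k ∈ Finset.Icc (-(N : ℤ)) (N : ℤ), c k * fourier k x)
    (hmean : ∫ x, u x ∂(haarAddCircle : Measure Torus) = 0) : c 0 = 0 := by
  have h0 : (0 : ℤ) ∈ Finset.Icc (-(N : ℤ)) (N : ℤ) := by simp
  rw [← fourierCoeff_trigPoly hu h0]
  unfold fourierCoeff
  simp only [neg_zero, fourier_zero, one_smul]
  rw [integral_complex_ofReal, hmean, Complex.ofReal_zero]

theorem fourierCoeff_mulOp {N : ℕ} {c : ℤ → ℂ} {u : C(Torus, ℝ)}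
    (hu : ∀ x : Torus, (u x : ℂ) = ∑ k ∈ Finset.Icc (-(N : ℤ)) (N : ℤ), c k * fourier k x)
    (f : L2) (n : ℤ) :
    fourierCoeff (mulOp u f : L2) n =
      ∑ k ∈ Finset.Icc (-(N : ℤ)) (N : ℤ), c k * fourierCoeff f (n - k) := by
  rw [← fourierCoeff_trigPoly_mul N c ((Lp.memLp f).integrable (by norm_num)) n]
  apply congrFun
  apply fourierCoeff_congr_ae
  filter_upwards [(memLp_mul u f).coeFn_toLp] with x hx
  rw [← hu]
  exact hx

theorem fourierLp_mem_hardySpace {n : ℤ} (hn : 0 ≤ n) : (fourierLp 2 n : L2) ∈ hardySpace := by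
  intro m hm
  rw [← fourierBasis_repr, ← coe_fourierBasis, HilbertBasis.repr_self]
  simp [lp.single_apply, show m ≠ n by omega]

/-- For `n ≥ 0` the exponential lies in the Hardy space, and an orthogonal projection preserves
inner products with vectors of its range. -/
theorem fourierCoeff_szego (f : L2) {n : ℤ} (hn : 0 ≤ n) :
    fourierCoeff (szego f : L2) n = fourierCoeff f n := by
  rw [← fourierBasis_repr, ← fourierBasis_repr, HilbertBasis.repr_apply_apply,
    HilbertBasis.repr_apply_apply, coe_fourierBasis]
  exact Submodule.inner_orthogonalProjectionOnto_eq_of_mem_left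
    (⟨_, fourierLp_mem_hardySpace hn⟩ : hardySpace) f

theorem exists_hardySpace_fourierCoeff {a : ℤ → ℂ} (ha : ∀ n < 0, a n = 0) (h2 : Memℓp a 2) :
    ∃ f : hardySpace, ∀ n, fourierCoeff (f : L2) n = a n := by
  have h (n : ℤ) : fourierCoeff ((fourierBasis (T := 2 * π)).repr.symm ⟨a, h2⟩ : L2) n = a n := by
    rw [← fourierBasis_repr, LinearIsometryEquiv.apply_symm_apply]
  exact ⟨⟨_, fun n hn => (h n).trans (ha n hn)⟩, h⟩

theorem hardySpace_ext {f g : hardySpace}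
    (h : ∀ n : ℤ, 0 ≤ n → fourierCoeff (f : L2) n = fourierCoeff (g : L2) n) : f = g := by
  apply Subtype.ext
  apply (fourierBasis (T := 2 * π)).repr.injective
  ext n
  rw [fourierBasis_repr, fourierBasis_repr]
  rcases lt_or_ge n 0 with hn | hn
  · rw [f.2 n hn, g.2 n hn]
  · exact h n hn

theorem memℓp_fourierCoeff (f : L2) : Memℓp (fun n => fourierCoeff f n) 2 := by
  have h := lp.memℓp ((fourierBasis (T := 2 * π)).repr f)
  have h' : (fun n => fourierCoeff f n) = ((fourierBasis (T := 2 * π)).repr f : ℤ → ℂ) :=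
    funext fun n => (fourierBasis_repr f n).symm
  rwa [h']

/-- The sequence of Fourier coefficients of an eigenvector of the Lax operator. -/
structure IsEigenSeq (N : ℕ) (c : ℤ → ℂ) (ε lam : ℝ) (a : ℤ → ℂ) : Prop where
  ne_zero : a ≠ 0
  eq_zero : ∀ n < 0, a n = 0
  memℓp : Memℓp a 2
  memℓp_deriv : Memℓp (fun n : ℤ => (n : ℂ) * a n) 2
  recurrence : ∀ n : ℤ, 0 ≤ n →
    ε * n * a n - ∑ k ∈ Finset.Icc (-(N : ℤ)) (N : ℤ), c k * a (n - k) = lam * a n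

theorem fourierCoeff_laxOperator {N : ℕ} {c : ℤ → ℂ} {u : C(Torus, ℝ)}
    (hu : ∀ x : Torus, (u x : ℂ) = ∑ k ∈ Finset.Icc (-(N : ℤ)) (N : ℤ), c k * fourier k x)
    (ε : ℝ) (f : (laxOperator u ε).domain) {n : ℤ} (hn : 0 ≤ n) :
    fourierCoeff (laxOperator u ε f : L2) n =
      ε * n * fourierCoeff ((f : hardySpace) : L2) n -
        ∑ k ∈ Finset.Icc (-(N : ℤ)) (N : ℤ), c k * fourierCoeff ((f : hardySpace) : L2) (n - k) := by
  have h1 : (laxOperator u ε f : L2) = (-(Complex.I * ε)) • (derivOp f : L2) -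
      (szego (mulOp u ((f : hardySpace) : L2)) : L2) := rfl
  have h2 := isDeriv_derivOp f n
  have h3 := fourierCoeff_szego (mulOp u ((f : hardySpace) : L2)) hn
  rw [fourierCoeff_mulOp hu] at h3
  rw [h1, ← h3]
  rw [← fourierBasis_repr] at h2 ⊢
  rw [← fourierBasis_repr (szego _ : L2)]
  simp only [map_sub, map_smul, lp.coeFn_sub, lp.coeFn_smul, Pi.sub_apply, Pi.smul_apply, h2,
    smul_eq_mul]
  linear_combination (-(ε : ℂ) * n * fourierCoeff ((f : hardySpace) : L2) n) * Complex.I_mul_I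

theorem isEigenvalue_iff_exists_isEigenSeq {N : ℕ} {c : ℤ → ℂ} {u : C(Torus, ℝ)}
    (hu : ∀ x : Torus, (u x : ℂ) = ∑ k ∈ Finset.Icc (-(N : ℤ)) (N : ℤ), c k * fourier k x)
    (ε lam : ℝ) :
    IsEigenvalue (laxOperator u ε) (lam : ℂ) ↔ ∃ a, IsEigenSeq N c ε lam a := by
  have hsmul (g : hardySpace) (n : ℤ) :
      fourierCoeff (((lam : ℂ) • g : hardySpace) : L2) n = lam * fourierCoeff (g : L2) n := by
    rw [← fourierBasis_repr, ← fourierBasis_repr, Submodule.coe_smul, map_smul]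
    rfl
  constructor
  · rintro ⟨f, hf0, hf⟩
    refine ⟨fun n => fourierCoeff ((f : hardySpace) : L2) n, ?_, (f : hardySpace).2,
      memℓp_fourierCoeff _, ?_, ?_⟩
    · intro h
      refine hf0 (Subtype.ext (hardySpace_ext fun n _ => (congrFun h n).trans ?_))
      rw [← fourierBasis_repr]
      simp
    · have h := (memℓp_fourierCoeff (derivOp f : L2)).const_smul (-Complex.I)
      convert h using 1
      ext n
      simp only [Pi.smul_apply, smul_eq_mul, isDeriv_derivOp f n]
      linear_combination ((n : ℂ) * fourierCoeff ((f : hardySpace) : L2) n) * Complex.I_mul_I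
    · intro n hn
      rw [← fourierCoeff_laxOperator hu ε f hn, hf, hsmul]
  · rintro ⟨a, ha⟩
    obtain ⟨f, hf⟩ := exists_hardySpace_fourierCoeff ha.eq_zero ha.memℓp
    obtain ⟨g, hg⟩ := exists_hardySpace_fourierCoeff (a := fun n : ℤ => Complex.I * ((n : ℂ) * a n))
      (fun n hn => by simp [ha.eq_zero n hn]) (ha.memℓp_deriv.const_smul Complex.I)
    have hfg : IsDeriv f g := fun n => by rw [hf, hg]; ring
    let f' : (laxOperator u ε).domain := ⟨f, g, hfg⟩
    refine ⟨f', ?_, ?_⟩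
    · intro h
      apply ha.ne_zero
      ext n
      have h' : f = 0 := congrArg Subtype.val h
      rw [← hf, h', ← fourierBasis_repr]
      simp
    · refine hardySpace_ext fun n hn => ?_
      rw [fourierCoeff_laxOperator hu ε f' hn, hsmul]
      simp only [f', hf]
      exact ha.recurrence n hn

/-! ### Laurent polynomials in the logarithmic coordinate -/

/-- The Laurent polynomial `∑_{|k| ≤ N} d_k z ^ k` at `z = e ^ ξ`. -/
def laurent (N : ℕ) (d : ℤ → ℂ) (ξ : ℂ) : ℂ :=
  ∑ k ∈ Finset.Icc (-(N : ℤ)) (N : ℤ), d k * Complex.exp (k * ξ)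

/-- The Laurent polynomial `∑_{l = 1}^N b_l z ^ {-l}` at `z = e ^ ξ`; the coefficients are numbered
from `0`. -/
def negPart (N : ℕ) (b : Fin N → ℂ) (ξ : ℂ) : ℂ :=
  ∑ j : Fin N, b j * Complex.exp (-((j : ℕ) + 1 : ℂ) * ξ)

/-- The integrating factor `e ^ {Q(z) / ε} z ^ {-λ / ε}` at `z = e ^ ξ`. -/
def weight (N : ℕ) (c : ℤ → ℂ) (ε lam : ℝ) (ξ : ℂ) : ℂ :=
  Complex.exp (-(laurent N (fun k => c k / k) ξ) / ε - lam / ε * ξ)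

/-- The coefficients of a real zero-mean trigonometric polynomial of order `N` with `c_N > 0`. -/
structure IsPotential (N : ℕ) (c : ℤ → ℂ) : Prop where
  one_le : 1 ≤ N
  zero : c 0 = 0
  conj_eq : ∀ k : ℕ, k ∈ Finset.Icc 1 N → c (-(k : ℤ)) = conj (c k)
  re_pos : 0 < (c N).re
  im_eq : (c N).im = 0

theorem IsPotential.top_eq {N : ℕ} {c : ℤ → ℂ} (hc : IsPotential N c) :
    c N = ((c N).re : ℂ) := by
  apply Complex.ext <;> simp [hc.im_eq]

theorem IsPotential.bot_eq {N : ℕ} {c : ℤ → ℂ} (hc : IsPotential N c) :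
    c (-(N : ℤ)) = ((c N).re : ℂ) := by
  rw [hc.conj_eq N (by simp [hc.one_le]), hc.top_eq, Complex.conj_ofReal, Complex.ofReal_re]

theorem IsPotential.bot_ne_zero {N : ℕ} {c : ℤ → ℂ} (hc : IsPotential N c) :
    c (-(N : ℤ)) ≠ 0 := by
  rw [hc.bot_eq]; exact_mod_cast hc.re_pos.ne'

theorem hasDerivAt_laurent (N : ℕ) (d : ℤ → ℂ) (ξ : ℂ) :
    HasDerivAt (laurent N d) (laurent N (fun k => d k * k) ξ) ξ := by
  unfold laurent
  refine HasDerivAt.fun_sum fun k _ => ?_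
  have h := (((hasDerivAt_id ξ).const_mul (k : ℂ)).cexp).const_mul (d k)
  refine h.congr_deriv ?_
  simp only [id]
  ring

theorem laurent_add_two_pi (N : ℕ) (d : ℤ → ℂ) (ξ : ℂ) :
    laurent N d (ξ + 2 * π * Complex.I) = laurent N d ξ := by
  unfold laurent
  refine Finset.sum_congr rfl fun k _ => ?_
  rw [mul_add, Complex.exp_add, Complex.exp_int_mul_two_pi_mul_I, mul_one]

theorem hasDerivAt_logWeight {N : ℕ} {c : ℤ → ℂ} (hc0 : c 0 = 0) (ε lam : ℝ) (ξ : ℂ) :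
    HasDerivAt (fun ξ => -(laurent N (fun k => c k / k) ξ) / ε - lam / ε * ξ)
      (-(laurent N c ξ + lam) / ε) ξ := by
  refine (((hasDerivAt_laurent N (fun k => c k / k) ξ).neg.div_const (ε : ℂ)).sub
    ((hasDerivAt_id ξ).const_mul ((lam : ℂ) / ε))).congr_deriv ?_
  have h1 : laurent N (fun k => c k / k * k) ξ = laurent N c ξ := by
    unfold laurent
    refine Finset.sum_congr rfl fun k _ => ?_
    -- The term `k = 0` contains `c 0 / 0 = 0`; it has the right derivative because the mean `c 0`
    -- vanishes.
    rcases eq_or_ne k 0 with rfl | hk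
    · simp [hc0]
    · have hk' : (k : ℂ) ≠ 0 := by exact_mod_cast hk
      simp only [div_mul_cancel₀ _ hk']
  rw [h1]
  ring

theorem hasDerivAt_weight {N : ℕ} {c : ℤ → ℂ} (hc0 : c 0 = 0) (ε lam : ℝ) (ξ : ℂ) :
    HasDerivAt (weight N c ε lam) (-(laurent N c ξ + lam) / ε * weight N c ε lam ξ) ξ :=
  (hasDerivAt_logWeight hc0 ε lam ξ).cexp.congr_deriv (mul_comm _ _)

theorem weight_ne_zero (N : ℕ) (c : ℤ → ℂ) (ε lam : ℝ) (ξ : ℂ) : weight N c ε lam ξ ≠ 0 :=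
  Complex.exp_ne_zero _

theorem weight_add_two_pi (N : ℕ) (c : ℤ → ℂ) (ε lam : ℝ) (ξ : ℂ) :
    weight N c ε lam (ξ + 2 * π * Complex.I) =
      Complex.exp (-(2 * π * Complex.I * lam / ε)) * weight N c ε lam ξ := by
  unfold weight
  rw [laurent_add_two_pi, ← Complex.exp_add]
  congr 1
  ring

theorem negPart_add_two_pi (N : ℕ) (b : Fin N → ℂ) (ξ : ℂ) :
    negPart N b (ξ + 2 * π * Complex.I) = negPart N b ξ := by
  unfold negPart
  refine Finset.sum_congr rfl fun k _ => ?_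
  have h := Complex.exp_int_mul_two_pi_mul_I (-((k : ℕ) + 1 : ℤ))
  push_cast at h
  rw [mul_add, Complex.exp_add, h, mul_one]

/-- Near `z = 0` the power `z^{-N}` dominates; every other exponent is at least `1 - N`, so the
remainder is smaller by a factor `|z| = e^{Re ξ}`. -/
theorem exists_norm_laurent_sub_le (N : ℕ) (d : ℤ → ℂ) :
    ∃ D : ℝ, 0 ≤ D ∧ ∀ ξ : ℂ, ξ.re ≤ 0 →
      ‖laurent N d ξ - d (-(N : ℤ)) * Complex.exp (-(N : ℂ) * ξ)‖ ≤
        D * Real.exp (-((N : ℝ) - 1) * ξ.re) := by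
  set S := (Finset.Icc (-(N : ℤ)) (N : ℤ)).erase (-(N : ℤ)) with hS
  refine ⟨∑ k ∈ S, ‖d k‖, Finset.sum_nonneg fun _ _ => norm_nonneg _, fun ξ hξ => ?_⟩
  have h : laurent N d ξ - d (-(N : ℤ)) * Complex.exp (-(N : ℂ) * ξ) =
      ∑ k ∈ S, d k * Complex.exp (k * ξ) := by
    have := Finset.add_sum_erase (Finset.Icc (-(N : ℤ)) (N : ℤ))
      (fun k : ℤ => d k * Complex.exp (k * ξ)) (a := -(N : ℤ)) (by simp)
    rw [laurent, ← this]
    simp [hS]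
  rw [h, Finset.sum_mul]
  refine (norm_sum_le _ _).trans (Finset.sum_le_sum fun k hk => ?_)
  rw [norm_mul, Complex.norm_exp]
  have hk' : (1 : ℝ) - N ≤ k := by
    rw [hS, Finset.mem_erase, Finset.mem_Icc] at hk
    have : (1 : ℤ) - N ≤ k := by omega
    exact_mod_cast this
  gcongr
  rw [show ((k : ℂ) * ξ).re = k * ξ.re by simp]
  nlinarith

theorem exists_norm_negPart_le (N : ℕ) (b : Fin N → ℂ) :
    ∃ D : ℝ, 0 ≤ D ∧ ∀ ξ : ℂ, ξ.re ≤ 0 → ‖negPart N b ξ‖ ≤ D * Real.exp (-(N : ℝ) * ξ.re) := by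
  refine ⟨∑ j, ‖b j‖, Finset.sum_nonneg fun _ _ => norm_nonneg _, fun ξ hξ => ?_⟩
  rw [Finset.sum_mul]
  refine (norm_sum_le _ _).trans (Finset.sum_le_sum fun k _ => ?_)
  rw [norm_mul, Complex.norm_exp]
  have hk : ((k : ℕ) : ℝ) + 1 ≤ N := by exact_mod_cast k.2
  gcongr
  rw [show (-((k : ℕ) + 1 : ℂ) * ξ).re = -((k : ℕ) + 1 : ℝ) * ξ.re by simp]
  nlinarith

theorem exp_nat_mul_split (N : ℕ) (s : ℝ) :
    Real.exp (-(N : ℝ) * s) = Real.exp (-s) * Real.exp (-((N : ℝ) - 1) * s) := by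
  rw [← Real.exp_add]; congr 1; ring

theorem exp_neg_nat_mul (N : ℕ) (ξ : ℂ) : Complex.exp (-(N : ℂ) * ξ) =
    (Real.exp (-(N : ℝ) * ξ.re) : ℂ) * Complex.exp (-(N : ℂ) * ξ.im * Complex.I) := by
  rw [Complex.ofReal_exp, ← Complex.exp_add]
  congr 1
  conv_lhs => rw [← Complex.re_add_im ξ]
  push_cast
  ring

/-- In every direction `d` in which the leading term of the potential makes the modulus of the
integrating factor increase, its logarithmic derivative dominates `negPart N b`. -/
theorem exists_norm_negPart_le_re {N : ℕ} {c : ℤ → ℂ} (hc : IsPotential N c) {ε : ℝ} (hε : 0 < ε)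
    (lam : ℝ) (b : Fin N → ℂ) :
    ∃ s₀ ≤ (0 : ℝ), ∃ C : ℝ, 0 ≤ C ∧ ∀ d ξ : ℂ, ‖d‖ = 1 → ξ.re ≤ s₀ →
      (Complex.exp (-(N : ℂ) * ξ.im * Complex.I) * d).re ≤ -(1 / 2) →
      0 ≤ (-(laurent N c ξ + lam) / ε * d).re ∧
        ‖negPart N b ξ‖ ≤ C * (-(laurent N c ξ + lam) / ε * d).re := by
  obtain ⟨D, hD0, hD⟩ := exists_norm_laurent_sub_le N c
  obtain ⟨D', hD'0, hD'⟩ := exists_norm_negPart_le N b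
  set κ := (c N).re with hκ
  have hκ0 : 0 < κ := hc.re_pos
  -- The leading term contributes at least `κ/2 · e^{-Ns}`. This threshold makes the remainder and
  -- `λ` cost at most `κ/4 · e^{-Ns}`, so that `κ/4 · e^{-Ns}` is left.
  obtain ⟨s₁, hs₁⟩ := (((Real.tendsto_exp_atTop.comp tendsto_neg_atBot_atTop).eventually_ge_atTop
    (4 * (D + |lam|) / κ)).and (eventually_le_atBot (0 : ℝ))).exists
  have hN1 : (1 : ℝ) ≤ N := by exact_mod_cast hc.one_le
  refine ⟨s₁, hs₁.2, D' * (4 * ε / κ), by positivity, fun d ξ hd hξ hdir => ?_⟩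
  have hξ0 : ξ.re ≤ 0 := hξ.trans hs₁.2
  set s := ξ.re with hs
  set y := Real.exp (-((N : ℝ) - 1) * s) with hy
  have hy1 : 1 ≤ y := by
    rw [hy, Real.one_le_exp_iff]; nlinarith
  have hX : Real.exp (-(N : ℝ) * s) = Real.exp (-s) * y := exp_nat_mul_split N s
  have hx : 4 * (D + |lam|) ≤ κ * Real.exp (-s) := by
    have h1 : 4 * (D + |lam|) / κ ≤ Real.exp (-s) :=
      hs₁.1.trans (Real.exp_le_exp.2 (by linarith))
    rw [div_le_iff₀ hκ0] at h1
    linarith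
  set r := laurent N c ξ - c (-(N : ℤ)) * Complex.exp (-(N : ℂ) * ξ) with hr
  have hr' : ‖r‖ ≤ D * y := hD ξ hξ0
  have hdec : ((laurent N c ξ + lam) * d).re =
      κ * Real.exp (-(N : ℝ) * s) * (Complex.exp (-(N : ℂ) * ξ.im * Complex.I) * d).re +
        ((r + lam) * d).re := by
    have : (laurent N c ξ + lam) * d = ((κ * Real.exp (-(N : ℝ) * s) : ℝ) : ℂ) *
        (Complex.exp (-(N : ℂ) * ξ.im * Complex.I) * d) + (r + lam) * d := by
      rw [hr, hc.bot_eq, exp_neg_nat_mul]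
      push_cast
      ring
    rw [this, Complex.add_re, Complex.re_ofReal_mul]
  have hrest : ((r + lam) * d).re ≤ (D + |lam|) * y := by
    refine (Complex.re_le_norm _).trans ?_
    rw [norm_mul, hd, mul_one]
    refine (norm_add_le _ _).trans ?_
    rw [Complex.norm_real, Real.norm_eq_abs]
    nlinarith [abs_nonneg lam]
  have hmain : κ / 4 * Real.exp (-(N : ℝ) * s) ≤ -((laurent N c ξ + lam) * d).re := by
    have hX0 : 0 < κ * Real.exp (-(N : ℝ) * s) := by positivity
    rw [hdec]
    have h2 : 4 * ((D + |lam|) * y) ≤ κ * Real.exp (-(N : ℝ) * s) := by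
      rw [hX]
      nlinarith
    nlinarith
  have hfin : (-(laurent N c ξ + lam) / ε * d).re = -((laurent N c ξ + lam) * d).re / ε := by
    rw [show -(laurent N c ξ + lam) / ε * d = (((1 / ε : ℝ)) : ℂ) * (-((laurent N c ξ + lam) * d)) by
      push_cast; ring, Complex.re_ofReal_mul, Complex.neg_re]
    ring
  rw [hfin]
  refine ⟨div_nonneg (le_trans (by positivity) hmain) hε.le, ?_⟩
  calc ‖negPart N b ξ‖ ≤ D' * Real.exp (-(N : ℝ) * s) := hD' ξ hξ0
    _ = D' * (4 / κ) * (κ / 4 * Real.exp (-(N : ℝ) * s)) := by field_simp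
    _ ≤ D' * (4 / κ) * (-((laurent N c ξ + lam) * d).re) := by gcongr
    _ = _ := by field_simp

/-- Where `cos (Nθ) ≤ -1/2`, the real part of the leading term of `Q` is at most `-κ/(2N) ·
|z|^{-N}`, and half of this absorbs the other terms. The bound is uniform in the angle, and the
power `e^{-ms}` leaves room for the factors `z^{-l}`. -/
theorem exists_norm_weight_le {N : ℕ} {c : ℤ → ℂ} (hc : IsPotential N c) {ε : ℝ} (hε : 0 < ε)
    (lam m : ℝ) :
    ∃ B : ℝ → ℝ, Tendsto B atBot (𝓝 0) ∧ ∀ᶠ s : ℝ in atBot, ∀ θ : ℝ, Real.cos (N * θ) ≤ -(1 / 2) →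
      ‖weight N c ε lam (s + θ * Complex.I)‖ * Real.exp (-m * s) ≤ B s := by
  obtain ⟨D, hD0, hD⟩ := exists_norm_laurent_sub_le N (fun k => c k / k)
  set κ := (c N).re with hκ
  have hκ0 : 0 < κ := hc.re_pos
  have hN1 : (1 : ℝ) ≤ N := by exact_mod_cast hc.one_le
  have hN0 : (N : ℝ) ≠ 0 := by positivity
  set κ' := κ / (4 * N) with hκ'
  have hκ'0 : 0 < κ' := by positivity
  -- With `x = e^{-s} = 1/|z|` this is `x^{λ/ε + m} e^{-κ'x/ε}`; the decay is stated in `x` instead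
  -- of `x^N`, which is enough.
  refine ⟨fun s => Real.exp (-s) ^ (lam / ε + m) * Real.exp (-(κ' / ε) * Real.exp (-s)), ?_, ?_⟩
  · exact (tendsto_rpow_mul_exp_neg_mul_atTop_nhds_zero _ _ (by positivity)).comp
      (Real.tendsto_exp_atTop.comp tendsto_neg_atBot_atTop)
  filter_upwards [(Real.tendsto_exp_atTop.comp tendsto_neg_atBot_atTop).eventually_ge_atTop
    (D / κ'), eventually_le_atBot (0 : ℝ)] with s hs1 hs0 θ hθ
  set ξ : ℂ := s + θ * Complex.I with hξ
  have hre : ξ.re = s := by simp [hξ]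
  have him : ξ.im = θ := by simp [hξ]
  set y := Real.exp (-((N : ℝ) - 1) * s) with hy
  have hy1 : 1 ≤ y := by
    rw [hy, Real.one_le_exp_iff]; nlinarith
  have hX : Real.exp (-(N : ℝ) * s) = Real.exp (-s) * y := exp_nat_mul_split N s
  have hx : D ≤ κ' * Real.exp (-s) := by
    have h1 : D / κ' ≤ Real.exp (-s) := hs1
    rw [div_le_iff₀ hκ'0] at h1
    linarith
  have hr := hD ξ (by rw [hre]; exact hs0)
  set r := laurent N (fun k => c k / k) ξ -
    c (-(N : ℤ)) / ((-(N : ℤ) : ℤ) : ℂ) * Complex.exp (-(N : ℂ) * ξ) with hrdef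
  rw [hre, ← hy] at hr
  have hNC : (N : ℂ) ≠ 0 := by exact_mod_cast hN0
  have hlead : laurent N (fun k => c k / k) ξ =
      ((-(κ / N * Real.exp (-(N : ℝ) * s)) : ℝ) : ℂ) *
        Complex.exp (((-(N * θ) : ℝ) : ℂ) * Complex.I) + r := by
    rw [hrdef, hc.bot_eq, exp_neg_nat_mul, hre, him]
    push_cast
    field_simp
    ring
  have hre' : (laurent N (fun k => c k / k) ξ).re =
      -(κ / N * Real.exp (-(N : ℝ) * s)) * Real.cos (N * θ) + r.re := by
    rw [hlead, Complex.add_re, Complex.re_ofReal_mul, Complex.exp_ofReal_mul_I_re, Real.cos_neg]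
  have hrr : -(D * y) ≤ r.re := (neg_le_neg hr).trans (Complex.abs_re_le_norm r |> abs_le.1).1
  have hlow : κ' * Real.exp (-s) ≤ (laurent N (fun k => c k / k) ξ).re := by
    have hK : κ / N * Real.exp (-(N : ℝ) * s) = 4 * (κ' * Real.exp (-s) * y) := by
      rw [hX, hκ']; field_simp
    rw [hre', hK]
    have hZ : 0 < κ' * Real.exp (-s) := by positivity
    have hZy : κ' * Real.exp (-s) ≤ κ' * Real.exp (-s) * y := le_mul_of_one_le_right hZ.le hy1
    nlinarith
  rw [weight, Complex.norm_exp, ← Real.exp_add, ← Real.exp_mul, ← Real.exp_add, Real.exp_le_exp]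
  have h1 : (-(laurent N (fun k => c k / k) ξ) / ε - lam / ε * ξ).re =
      -(laurent N (fun k => c k / k) ξ).re / ε - lam / ε * s := by
    rw [show -(laurent N (fun k => c k / k) ξ) / ε - lam / ε * ξ =
      ((1 / ε : ℝ) : ℂ) * (-(laurent N (fun k => c k / k) ξ)) - ((lam / ε : ℝ) : ℂ) * ξ by
        push_cast; ring,
      Complex.sub_re, Complex.re_ofReal_mul, Complex.re_ofReal_mul, hre, Complex.neg_re]
    ring
  rw [h1]
  have h2 : κ' * Real.exp (-s) / ε ≤ (laurent N (fun k => c k / k) ξ).re / ε := by gcongr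
  have h3 : κ' / ε * Real.exp (-s) = κ' * Real.exp (-s) / ε := by ring
  rw [neg_mul (κ' / ε), h3, neg_div]
  linarith

/-! ### The contour integrals -/

theorem sum_Icc_neg_natCast {M : Type*} [AddCommMonoid M] (f : ℤ → M) (N : ℕ) :
    ∑ k ∈ Finset.Icc (-(N : ℤ)) (N : ℤ), f k =
      f 0 + ∑ k ∈ Finset.Icc 1 N, (f k + f (-(k : ℤ))) := by
  induction N with
  | zero => simp
  | succ n ih =>
    have h : Finset.Icc (-((n + 1 : ℕ) : ℤ)) ((n + 1 : ℕ) : ℤ) =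
        insert ((n + 1 : ℕ) : ℤ) (insert (-((n + 1 : ℕ) : ℤ)) (Finset.Icc (-(n : ℤ)) (n : ℤ))) := by
      ext k
      simp only [Finset.mem_Icc, Finset.mem_insert]
      omega
    rw [h, Finset.sum_insert, Finset.sum_insert, ih, Finset.sum_Icc_succ_top (by omega)]
    · abel
    · simp
    · simp only [Finset.mem_Icc, Finset.mem_insert]
      omega

/-- The two halves of the Laurent sum match by `c_{-k} = conj c_k`; the sign of `Q` on negative
powers comes from the division by `-k`. -/
theorem Q_exp {N : ℕ} {c : ℤ → ℂ} (hc : IsPotential N c) (ξ : ℂ) :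
    Q N c (Complex.exp ξ) = -laurent N (fun k => c k / k) ξ := by
  rw [laurent, sum_Icc_neg_natCast, Q]
  simp only [Int.cast_zero, div_zero, zero_mul, zero_add]
  rw [← Finset.sum_neg_distrib]
  refine Finset.sum_congr rfl fun k hk => ?_
  rw [hc.conj_eq k hk, ← Complex.exp_nat_mul, ← Complex.exp_neg]
  push_cast
  rw [neg_mul (k : ℂ) ξ]
  ring

theorem powCut_exp {ξ : ℂ} (h0 : 0 < ξ.im) (h1 : ξ.im < 2 * π) (s : ℂ) :
    powCut (Complex.exp ξ) s = Complex.exp (s * ξ) := by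
  have h : -Complex.exp ξ = Complex.exp (ξ - π * Complex.I) := by
    rw [Complex.exp_sub, Complex.exp_pi_mul_I, div_neg, div_one]
  rw [powCut, logCut, h, Complex.log_exp]
  · rw [sub_add_cancel]
  · simp; linarith
  · simp; linarith

/-- The strip `0 < Im ξ < 2π` is the one on which `ξ` is the chosen logarithm of `e^ξ`. The quotient
by `e^ξ` disappears in `dζ / ζ = dξ`. -/
theorem form_exp {N : ℕ} {c : ℤ → ℂ} (hc : IsPotential N c) (ε lam : ℝ) (l : ℕ) {ξ : ℂ}
    (h0 : 0 < ξ.im) (h1 : ξ.im < 2 * π) (v : ℂ) :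
    form N c ε lam l (Complex.exp ξ) v =
      weight N c ε lam ξ * Complex.exp (-(l : ℂ) * ξ) / Complex.exp ξ * v := by
  rw [form, Q_exp hc, powCut_exp h0 h1, ← Complex.exp_add, weight, ← Complex.exp_add]
  simp only [smul_apply, ContinuousLinearMap.id_apply, smul_eq_mul]
  congr 3
  ring

/-! ### Integrals and primitives along a ray to the origin -/

section Ray

variable {φ Φ : ℂ → ℂ} {θ : ℝ}

theorem continuousOn_ray (hφ : Continuous φ)
    (h0 : Tendsto (fun s : ℝ => φ (s + θ * Complex.I) * Complex.exp (-(s : ℂ))) atBot (𝓝 0)) :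
    ContinuousOn (fun t : ℝ => φ (Real.log t + θ * Complex.I) / t) (Set.Icc 0 1) := by
  intro t ht
  -- At `t = 0` division by zero gives the integrand the value `0`, which is also its limit: with `t
  -- = e^s` the integrand is the function in `h0`.
  rcases ht.1.eq_or_lt with rfl | ht0
  · have h := h0.comp Real.tendsto_log_nhdsGT_zero
    have h' : ContinuousWithinAt (fun t : ℝ => φ (Real.log t + θ * Complex.I) / t) (Set.Ioi 0) 0 := by
      unfold ContinuousWithinAt
      simp only [Complex.ofReal_zero, div_zero]
      refine h.congr' ?_
      filter_upwards [self_mem_nhdsWithin] with t (ht : 0 < t)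
      simp only [Function.comp]
      rw [← Complex.ofReal_neg, ← Complex.ofReal_exp, Real.exp_neg, Real.exp_log ht,
        Complex.ofReal_inv, div_eq_mul_inv]
    exact (continuousWithinAt_insert_self.2 h').mono fun x hx => by
      rcases hx.1.eq_or_lt with rfl | h
      · exact Set.mem_insert _ _
      · exact Set.mem_insert_of_mem _ h
  · refine ContinuousAt.continuousWithinAt ?_
    have h1 : ContinuousAt (fun t : ℝ => (Real.log t : ℂ) + θ * Complex.I) t :=
      (Complex.continuous_ofReal.continuousAt.comp (Real.continuousAt_log ht0.ne')).add
        continuousAt_const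
    exact (hφ.continuousAt.comp h1).div Complex.continuous_ofReal.continuousAt
      (by exact_mod_cast ht0.ne')

theorem intervalIntegrable_ray (hφ : Continuous φ)
    (h0 : Tendsto (fun s : ℝ => φ (s + θ * Complex.I) * Complex.exp (-(s : ℂ))) atBot (𝓝 0)) :
    IntervalIntegrable (fun t : ℝ => φ (Real.log t + θ * Complex.I) / t) volume 0 1 :=
  (continuousOn_ray hφ h0).intervalIntegrable_of_Icc zero_le_one

/-- The change of variable `s = log t` turns `s → -∞` into `t → 0` and the improper integral into a
proper one, so the limit exists by continuity of `x ↦ ∫ t in x..1`. -/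
theorem tendsto_primitive_ray (hΦ : ∀ ξ, HasDerivAt Φ (φ ξ) ξ) (hφ : Continuous φ)
    (h0 : Tendsto (fun s : ℝ => φ (s + θ * Complex.I) * Complex.exp (-(s : ℂ))) atBot (𝓝 0)) :
    Tendsto (fun s : ℝ => Φ (s + θ * Complex.I)) atBot
      (𝓝 (Φ (θ * Complex.I) - ∫ t in (0 : ℝ)..1, φ (Real.log t + θ * Complex.I) / t)) := by
  set g : ℝ → ℂ := fun t => φ (Real.log t + θ * Complex.I) / t with hg
  have hint : IntervalIntegrable g volume 0 1 := intervalIntegrable_ray hφ h0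
  have hprim : ∀ s : ℝ, s ≤ 0 →
      Φ (s + θ * Complex.I) = Φ (θ * Complex.I) - ∫ t in Real.exp s..1, g t := by
    intro s hs
    have hle : Real.exp s ≤ 1 := Real.exp_le_one_iff.2 hs
    have hder : ∀ t ∈ Set.uIcc (Real.exp s) 1,
        HasDerivAt (fun t : ℝ => Φ (Real.log t + θ * Complex.I)) (g t) t := by
      intro t ht
      rw [Set.uIcc_of_le hle] at ht
      have ht0 : 0 < t := (Real.exp_pos s).trans_le ht.1
      have h1 : HasDerivAt (fun t : ℝ => (Real.log t : ℂ) + θ * Complex.I) ((t⁻¹ : ℝ) : ℂ) t :=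
        ((Real.hasDerivAt_log ht0.ne').ofReal_comp).add_const _
      refine ((hΦ _).comp_of_eq t h1 rfl).congr_deriv ?_
      simp only [Complex.ofReal_inv, hg, div_eq_mul_inv]
    have hint' : IntervalIntegrable g volume (Real.exp s) 1 := by
      refine hint.mono_set ?_
      rw [Set.uIcc_of_le hle, Set.uIcc_of_le zero_le_one]
      exact Set.Icc_subset_Icc_left (Real.exp_pos s).le
    rw [intervalIntegral.integral_eq_sub_of_hasDerivAt hder hint']
    simp
  have hcont : ContinuousWithinAt (fun x => ∫ t in x..1, g t) (Set.Icc 0 1) 0 := by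
    have h := intervalIntegral.continuousOn_primitive_interval_left (f := g) (μ := volume)
      (a := 0) (b := 1) (by
        rw [Set.uIcc_of_le zero_le_one]
        exact (intervalIntegrable_iff_integrableOn_Icc_of_le zero_le_one).1 hint)
    rw [Set.uIcc_of_le zero_le_one] at h
    exact h 0 (by simp)
  have hexp : Tendsto Real.exp atBot (𝓝[Set.Icc 0 1] 0) := by
    refine tendsto_nhdsWithin_iff.2 ⟨Real.tendsto_exp_atBot, ?_⟩
    filter_upwards [eventually_le_atBot (0 : ℝ)] with s hs
    exact ⟨(Real.exp_pos s).le, Real.exp_le_one_iff.2 hs⟩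
  refine (tendsto_const_nhds.sub (hcont.tendsto.comp hexp)).congr' ?_
  filter_upwards [eventually_le_atBot (0 : ℝ)] with s hs
  rw [hprim s hs]
  rfl

end Ray

theorem circleMap_zero_one_eq (θ : ℝ) : circleMap 0 1 θ = Complex.exp (θ * Complex.I) := by
  simp [circleMap]

/-! ### The form on segments and arcs, in the logarithmic coordinate -/

section Form

variable {N : ℕ} {c : ℤ → ℂ} {ε lam : ℝ} {l : ℕ} {θ : ℝ}

theorem form_segment_apply (hc : IsPotential N c) (hθ0 : 0 < θ) (hθ1 : θ < 2 * π) {t : ℝ}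
    (ht : t ∈ Set.uIoc (0 : ℝ) 1) :
    form N c ε lam l (AffineMap.lineMap 0 (circleMap 0 1 θ) t) (circleMap 0 1 θ - 0) =
      weight N c ε lam (Real.log t + θ * Complex.I) *
        Complex.exp (-(l : ℂ) * (Real.log t + θ * Complex.I)) / t := by
  rw [Set.uIoc_of_le zero_le_one] at ht
  have ht0 : (t : ℂ) ≠ 0 := by exact_mod_cast ht.1.ne'
  have he : Complex.exp (Real.log t + θ * Complex.I) = t * circleMap 0 1 θ := by
    rw [Complex.exp_add, ← Complex.ofReal_exp, Real.exp_log ht.1, circleMap_zero_one_eq]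
  have hl : AffineMap.lineMap 0 (circleMap 0 1 θ) t =
      Complex.exp (Real.log t + θ * Complex.I) := by
    rw [he, AffineMap.lineMap_apply]
    simp
  rw [hl, form_exp hc _ _ _ (by simpa using hθ0) (by simpa using hθ1), he, sub_zero]
  have hw : circleMap 0 1 θ ≠ 0 := circleMap_ne_center one_ne_zero
  field_simp

theorem curveIntegrable_form_segment (hc : IsPotential N c) (hθ0 : 0 < θ) (hθ1 : θ < 2 * π)
    (hφ : Continuous fun ξ : ℂ => weight N c ε lam ξ * Complex.exp (-(l : ℂ) * ξ))
    (h0 : Tendsto (fun s : ℝ => weight N c ε lam (s + θ * Complex.I) *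
      Complex.exp (-(l : ℂ) * (s + θ * Complex.I)) * Complex.exp (-(s : ℂ))) atBot (𝓝 0)) :
    CurveIntegrable (form N c ε lam l) (Path.segment 0 (circleMap 0 1 θ)) := by
  rw [curveIntegrable_segment]
  refine (intervalIntegrable_congr fun t ht => form_segment_apply hc hθ0 hθ1 ht).2 ?_
  exact intervalIntegrable_ray hφ h0

theorem curveIntegral_form_segment (hc : IsPotential N c) (hθ0 : 0 < θ) (hθ1 : θ < 2 * π) :
    curveIntegral (form N c ε lam l) (Path.segment 0 (circleMap 0 1 θ)) =
      ∫ t in (0 : ℝ)..1, weight N c ε lam (Real.log t + θ * Complex.I) *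
        Complex.exp (-(l : ℂ) * (Real.log t + θ * Complex.I)) / t := by
  rw [curveIntegral_segment]
  refine intervalIntegral.integral_congr_ae ?_
  exact Eventually.of_forall fun t ht => form_segment_apply hc hθ0 hθ1 ht

/-- The endpoints are excluded because an arc may start or end at `1`, on the cut; this loses only a
null set. -/
theorem curveIntegralFun_form_arc (hc : IsPotential N c) {α β : ℝ} (hα : 0 ≤ α) (hαβ : α < β)
    (hβ : β ≤ 2 * π) {t : ℝ} (ht : t ∈ Set.Ioo (0 : ℝ) 1) :
    curveIntegralFun (form N c ε lam l) (arc α β) t =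
      weight N c ε lam ((α + t * (β - α) : ℝ) * Complex.I) *
        Complex.exp (-(l : ℂ) * ((α + t * (β - α) : ℝ) * Complex.I)) *
          ((β - α : ℝ) * Complex.I) := by
  have htI : t ∈ Set.Icc (0 : ℝ) 1 := Set.Ioo_subset_Icc_self ht
  have hext : Set.EqOn (arc α β).extend (fun t => circleMap 0 1 (α + t * (β - α)))
      (Set.Icc 0 1) := fun s hs => by
    rw [Path.extend_apply _ hs]; rfl
  have hd : HasDerivAt (fun t : ℝ => circleMap 0 1 (α + t * (β - α)))
      ((β - α : ℝ) • (circleMap 0 1 (α + t * (β - α)) * Complex.I)) t := by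
    have h1 : HasDerivAt (fun t : ℝ => α + t * (β - α)) (β - α) t := by
      simpa using ((hasDerivAt_id t).mul_const (β - α)).const_add α
    have h2 := hasDerivAt_circleMap 0 1 (α + t * (β - α))
    exact h2.scomp t h1
  rw [curveIntegralFun_def, hext htI, derivWithin_congr hext (hext htI),
    (hd.hasDerivWithinAt).derivWithin (uniqueDiffOn_Icc_zero_one t htI)]
  simp only
  have h3 : 0 < α + t * (β - α) := by nlinarith [mul_pos ht.1 (sub_pos.2 hαβ)]
  have h4 : α + t * (β - α) < 2 * π := by nlinarith [mul_pos (sub_pos.2 ht.2) (sub_pos.2 hαβ)]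
  rw [circleMap_zero_one_eq, form_exp hc _ _ _ (by simpa using h3) (by simpa using h4)]
  rw [Complex.real_smul]
  have := Complex.exp_ne_zero ((α + t * (β - α) : ℝ) * Complex.I)
  field_simp

theorem curveIntegralFun_form_arc_ae (hc : IsPotential N c) {α β : ℝ} (hα : 0 ≤ α) (hαβ : α < β)
    (hβ : β ≤ 2 * π) :
    curveIntegralFun (form N c ε lam l) (arc α β) =ᵐ[volume.restrict (Set.uIoc (0 : ℝ) 1)]
      fun t => weight N c ε lam ((α + t * (β - α) : ℝ) * Complex.I) *
        Complex.exp (-(l : ℂ) * ((α + t * (β - α) : ℝ) * Complex.I)) *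
          ((β - α : ℝ) * Complex.I) := by
  rw [Set.uIoc_of_le zero_le_one, ← restrict_Ioo_eq_restrict_Ioc]
  filter_upwards [ae_restrict_mem measurableSet_Ioo] with t ht
  exact curveIntegralFun_form_arc hc hα hαβ hβ ht

theorem curveIntegrable_form_arc (hc : IsPotential N c) {α β : ℝ} (hα : 0 ≤ α) (hαβ : α < β)
    (hβ : β ≤ 2 * π)
    (hφ : Continuous fun ξ : ℂ => weight N c ε lam ξ * Complex.exp (-(l : ℂ) * ξ)) :
    CurveIntegrable (form N c ε lam l) (arc α β) := by
  refine IntervalIntegrable.congr_ae ?_ (curveIntegralFun_form_arc_ae hc hα hαβ hβ).symm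
  refine Continuous.intervalIntegrable ?_ _ _
  exact (hφ.comp (by fun_prop : Continuous fun t : ℝ =>
    ((α + t * (β - α) : ℝ) : ℂ) * Complex.I)).mul continuous_const

theorem curveIntegral_form_arc (hc : IsPotential N c) {α β : ℝ} (hα : 0 ≤ α) (hαβ : α < β)
    (hβ : β ≤ 2 * π) {Φ : ℂ → ℂ}
    (hφ : Continuous fun ξ : ℂ => weight N c ε lam ξ * Complex.exp (-(l : ℂ) * ξ))
    (hΦ : ∀ ξ, HasDerivAt Φ (weight N c ε lam ξ * Complex.exp (-(l : ℂ) * ξ)) ξ) :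
    curveIntegral (form N c ε lam l) (arc α β) = Φ (β * Complex.I) - Φ (α * Complex.I) := by
  rw [curveIntegral_def,
    intervalIntegral.integral_congr_ae_restrict (curveIntegralFun_form_arc_ae hc hα hαβ hβ)]
  have hder : ∀ t ∈ Set.uIcc (0 : ℝ) 1,
      HasDerivAt (fun t : ℝ => Φ ((α + t * (β - α) : ℝ) * Complex.I))
        (weight N c ε lam ((α + t * (β - α) : ℝ) * Complex.I) *
          Complex.exp (-(l : ℂ) * ((α + t * (β - α) : ℝ) * Complex.I)) *
            ((β - α : ℝ) * Complex.I)) t := by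
    intro t _
    have h1 : HasDerivAt (fun t : ℝ => α + t * (β - α)) (β - α) t := by
      simpa using ((hasDerivAt_id t).mul_const (β - α)).const_add α
    exact (hΦ _).comp_of_eq t (h1.ofReal_comp.mul_const Complex.I) rfl
  rw [intervalIntegral.integral_eq_sub_of_hasDerivAt hder]
  · simp
  · refine Continuous.intervalIntegrable ?_ _ _
    exact (hφ.comp (by fun_prop : Continuous fun t : ℝ =>
      ((α + t * (β - α) : ℝ) : ℂ) * Complex.I)).mul continuous_const

end Form

/-! ### The matrix `A` in terms of limits along rays -/

/-- The angle `(2k - 1)π / N` for an integer `k`. -/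
def rayAngle (N : ℕ) (k : ℤ) : ℝ := (2 * (k : ℝ) - 1) * π / N

theorem theta_eq_rayAngle (N k : ℕ) : theta N k = rayAngle N k := by
  simp [theta, rayAngle]

theorem mul_rayAngle {N : ℕ} (hN : 1 ≤ N) (k : ℤ) : N * rayAngle N k = k * (2 * π) - π := by
  have : (N : ℝ) ≠ 0 := by positivity
  rw [rayAngle]; field_simp

theorem cos_mul_rayAngle {N : ℕ} (hN : 1 ≤ N) (k : ℤ) : Real.cos (N * rayAngle N k) = -1 := by
  rw [mul_rayAngle hN, Real.cos_sub_pi, Real.cos_int_mul_two_pi]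

theorem rayAngle_add {N : ℕ} (hN : 1 ≤ N) (k : ℤ) :
    rayAngle N (k + N) = rayAngle N k + 2 * π := by
  have : (N : ℝ) ≠ 0 := by positivity
  rw [rayAngle, rayAngle]; push_cast; field_simp; ring

theorem rayAngle_lt {N : ℕ} (hN : 1 ≤ N) {k m : ℤ} (h : k < m) : rayAngle N k < rayAngle N m := by
  have : (k : ℝ) < m := by exact_mod_cast h
  rw [rayAngle, rayAngle]
  gcongr

theorem rayAngle_pos {N : ℕ} (hN : 1 ≤ N) {k : ℤ} (h : 1 ≤ k) : 0 < rayAngle N k := by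
  have : (1 : ℝ) ≤ k := by exact_mod_cast h
  have : (0 : ℝ) < 2 * k - 1 := by linarith
  rw [rayAngle]; positivity

theorem rayAngle_lt_two_pi {N : ℕ} (hN : 1 ≤ N) {k : ℤ} (h : k ≤ N) : rayAngle N k < 2 * π := by
  have h1 : (k : ℝ) ≤ N := by exact_mod_cast h
  have h2 : (0 : ℝ) < N := by positivity
  rw [rayAngle, div_lt_iff₀ h2]
  nlinarith [Real.pi_pos]

section

variable {N : ℕ} {c : ℤ → ℂ} {ε : ℝ}

theorem differentiable_weight (hc : IsPotential N c) (ε lam : ℝ) :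
    Differentiable ℂ (weight N c ε lam) :=
  fun ξ => (hasDerivAt_weight hc.zero ε lam ξ).differentiableAt

theorem differentiable_weight_mul_exp (hc : IsPotential N c) (ε lam : ℝ) (l : ℕ) :
    Differentiable ℂ fun ξ : ℂ => weight N c ε lam ξ * Complex.exp (-(l : ℂ) * ξ) :=
  (differentiable_weight hc ε lam).mul (by fun_prop)

theorem tendsto_weight_ray (hc : IsPotential N c) (hε : 0 < ε) (lam : ℝ) (l : ℕ) {θ : ℝ}
    (hθ : Real.cos (N * θ) ≤ -(1 / 2)) :
    Tendsto (fun s : ℝ => weight N c ε lam (s + θ * Complex.I) *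
      Complex.exp (-(l : ℂ) * (s + θ * Complex.I)) * Complex.exp (-(s : ℂ))) atBot (𝓝 0) := by
  -- The exponent `l + 1` pays for `z^{-l}` and for the factor `e^{-s}` due to the change of
  -- variable.
  obtain ⟨B, hB, hle⟩ := exists_norm_weight_le hc hε lam (l + 1)
  refine squeeze_zero_norm' ?_ hB
  filter_upwards [hle] with s hs
  refine le_of_eq_of_le ?_ (hs θ hθ)
  rw [norm_mul, norm_mul, mul_assoc, Complex.norm_exp, Complex.norm_exp, ← Real.exp_add]
  congr 2
  simp
  ring

theorem tendsto_weight_ray_zero (hc : IsPotential N c) (hε : 0 < ε) (lam : ℝ) {θ : ℝ}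
    (hθ : Real.cos (N * θ) ≤ -(1 / 2)) :
    Tendsto (fun s : ℝ => weight N c ε lam (s + θ * Complex.I)) atBot (𝓝 0) := by
  obtain ⟨B, hB, hle⟩ := exists_norm_weight_le hc hε lam 0
  refine squeeze_zero_norm' ?_ hB
  filter_upwards [hle] with s hs
  simpa using hs θ hθ

theorem cos_rayAngle_le (hc : IsPotential N c) (k : ℤ) :
    Real.cos (N * rayAngle N k) ≤ -(1 / 2) := by
  rw [cos_mul_rayAngle hc.one_le]; norm_num

theorem curveIntegrable_ray (hc : IsPotential N c) (hε : 0 < ε) (lam : ℝ) (l : ℕ) {k : ℤ}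
    (h1 : 1 ≤ k) (h2 : k ≤ N) :
    CurveIntegrable (form N c ε lam l) (Path.segment 0 (circleMap 0 1 (rayAngle N k))) :=
  curveIntegrable_form_segment hc (rayAngle_pos hc.one_le h1) (rayAngle_lt_two_pi hc.one_le h2)
    (differentiable_weight_mul_exp hc ε lam l).continuous
    (tendsto_weight_ray hc hε lam l (cos_rayAngle_le hc k))

theorem integralsConverge (hc : IsPotential N c) (hε : 0 < ε) (lam : ℝ) :
    IntegralsConverge N c ε lam := by
  intro l _
  have hφ := (differentiable_weight_mul_exp hc ε lam l).continuous
  have hN := hc.one_le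
  have hray : ∀ k : ℕ, 1 ≤ k → k ≤ N →
      CurveIntegrable (form N c ε lam l) (Path.segment 0 (circleMap 0 1 (theta N k))) := by
    intro k h1 h2
    rw [theta_eq_rayAngle]
    exact curveIntegrable_ray hc hε lam l (by exact_mod_cast h1) (by exact_mod_cast h2)
  have hray' : ∀ k : ℕ, 1 ≤ k → k ≤ N →
      CurveIntegrable (form N c ε lam l) (Path.segment (circleMap 0 1 (theta N k)) 0) := by
    intro k h1 h2
    rw [← Path.segment_symm]
    exact (hray k h1 h2).symm
  refine ⟨fun k hk => ?_, ?_, ?_⟩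
  · rw [Finset.mem_Ico] at hk
    refine ((hray k hk.1 hk.2.le).trans ?_).trans (hray' (k + 1) (by omega) (by omega))
    rw [theta_eq_rayAngle, theta_eq_rayAngle]
    exact curveIntegrable_form_arc hc (rayAngle_pos hN (by omega)).le (rayAngle_lt hN (by simp))
      (rayAngle_lt_two_pi hN (by omega)).le hφ
  · refine CurveIntegrable.trans ?_ (hray' 1 le_rfl hN)
    rw [theta_eq_rayAngle]
    exact curveIntegrable_form_arc hc le_rfl (rayAngle_pos hN (by simp))
      (rayAngle_lt_two_pi hN (by omega)).le hφ
  · refine (hray N hN le_rfl).trans ?_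
    rw [theta_eq_rayAngle]
    exact curveIntegrable_form_arc hc (rayAngle_pos hN (by omega)).le
      (rayAngle_lt_two_pi hN (by omega)) le_rfl hφ

/-- Translation by `2πi` multiplies the integrand by a constant, so the two sides have the same
derivative; `K` is the constant of integration. -/
theorem exists_add_two_pi_eq {lam : ℝ} {P F : ℂ → ℂ}
    (hP : ∀ ξ, P (ξ + 2 * π * Complex.I) = P ξ)
    (hF : ∀ ξ, HasDerivAt F (weight N c ε lam ξ * P ξ) ξ) :
    ∃ K : ℂ, ∀ ξ, F (ξ + 2 * π * Complex.I) =
      Complex.exp (-(2 * π * Complex.I * lam / ε)) * F ξ + K := by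
  set e := Complex.exp (-(2 * π * Complex.I * lam / ε)) with he
  have hd : ∀ ξ, HasDerivAt (fun ξ => F (ξ + 2 * π * Complex.I) - e * F ξ) 0 ξ := by
    intro ξ
    have h1 := (hF (ξ + 2 * π * Complex.I)).comp_add_const ξ (2 * π * Complex.I)
    refine (h1.sub ((hF ξ).const_mul e)).congr_deriv ?_
    rw [weight_add_two_pi, hP, ← he]
    ring
  refine ⟨F (0 + 2 * π * Complex.I) - e * F 0, fun ξ => ?_⟩
  have := is_const_of_deriv_eq_zero (fun ξ => (hd ξ).differentiableAt) (fun ξ => (hd ξ).deriv) ξ 0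
  linear_combination this

/-- The limits of a primitive along the rays are quasi-periodic. -/
theorem limit_add_eq (hN : 1 ≤ N) {F : ℂ → ℂ} {e K : ℂ}
    (hK : ∀ ξ, F (ξ + 2 * π * Complex.I) = e * F ξ + K) {M : ℤ → ℂ}
    (hM : ∀ k, Tendsto (fun s : ℝ => F (s + rayAngle N k * Complex.I)) atBot (𝓝 (M k))) (k : ℤ) :
    M (k + N) = e * M k + K := by
  refine tendsto_nhds_unique (hM (k + N)) ((((hM k).const_mul e).add_const K).congr fun s => ?_)
  rw [← hK, rayAngle_add hN]
  congr 1
  push_cast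
  ring

/-- `M k` is the value of the primitive at the origin when approached along ray `k`, so the integral
over a contour from `0` to `0` telescopes to a difference of two such values. -/
theorem coeffA_eq (hc : IsPotential N c) (hε : 0 < ε) {lam : ℝ} {l : ℕ} {Φ : ℂ → ℂ} {M : ℤ → ℂ}
    (hΦ : ∀ ξ, HasDerivAt Φ (weight N c ε lam ξ * Complex.exp (-(l : ℂ) * ξ)) ξ)
    (hM : ∀ k, Tendsto (fun s : ℝ => Φ (s + rayAngle N k * Complex.I)) atBot (𝓝 (M k)))
    {k : ℕ} (h1 : 1 ≤ k) (h2 : k ≤ N) :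
    coeffA N c ε lam k l = (if k < N then 1 else Complex.exp (2 * π * Complex.I * lam / ε)) *
      (M (k + 1) - M k) := by
  have hφ := (differentiable_weight_mul_exp hc ε lam l).continuous
  have hN := hc.one_le
  have hconv := fun k : ℤ => tendsto_weight_ray hc hε lam l (cos_rayAngle_le hc k)
  have hseg : ∀ k : ℕ, 1 ≤ k → k ≤ N →
      curveIntegral (form N c ε lam l) (Path.segment 0 (circleMap 0 1 (theta N k))) =
        Φ (theta N k * Complex.I) - M k := by
    intro k h1 h2
    rw [theta_eq_rayAngle]
    have h3 := tendsto_nhds_unique (hM k) (tendsto_primitive_ray hΦ hφ (hconv k))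
    rw [h3, curveIntegral_form_segment hc (rayAngle_pos hN (by omega))
      (rayAngle_lt_two_pi hN (by omega)), sub_sub_cancel]
  have hseg' : ∀ k : ℕ, 1 ≤ k → k ≤ N →
      curveIntegral (form N c ε lam l) (Path.segment (circleMap 0 1 (theta N k)) 0) =
        M k - Φ (theta N k * Complex.I) := by
    intro k h1 h2
    rw [← Path.segment_symm, curveIntegral_symm, hseg k h1 h2, neg_sub]
  have hint : ∀ k : ℕ, 1 ≤ k → k ≤ N →
      CurveIntegrable (form N c ε lam l) (Path.segment 0 (circleMap 0 1 (theta N k))) := by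
    intro k h1 h2
    rw [theta_eq_rayAngle]
    exact curveIntegrable_ray hc hε lam l (by exact_mod_cast h1) (by exact_mod_cast h2)
  have hint' : ∀ k : ℕ, 1 ≤ k → k ≤ N →
      CurveIntegrable (form N c ε lam l) (Path.segment (circleMap 0 1 (theta N k)) 0) := by
    intro k h1 h2
    rw [← Path.segment_symm]
    exact (hint k h1 h2).symm
  have hpos : ∀ k : ℕ, 1 ≤ k → 0 < theta N k := fun k h => by
    rw [theta_eq_rayAngle]; exact rayAngle_pos hN (by omega)
  have hlt : ∀ k : ℕ, k ≤ N → theta N k < 2 * π := fun k h => by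
    rw [theta_eq_rayAngle]; exact rayAngle_lt_two_pi hN (by omega)
  unfold coeffA
  split_ifs with hk
  · have hlt' : theta N k < theta N (k + 1) := by
      rw [theta_eq_rayAngle, theta_eq_rayAngle]; exact rayAngle_lt hN (by simp)
    have harc := curveIntegrable_form_arc (l := l) hc (hpos k h1).le hlt' (hlt (k + 1) hk).le hφ
    rw [Gam, curveIntegral_trans ((hint k h1 h2).trans harc) (hint' (k + 1) (by omega) hk),
      curveIntegral_trans (hint k h1 h2) harc, hseg k h1 h2, hseg' (k + 1) (by omega) hk,
      curveIntegral_form_arc hc (hpos k h1).le hlt' (hlt (k + 1) hk).le hφ hΦ]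
    push_cast
    ring
  -- The two pieces of the last contour lie on different sheets: they give `M 1 - Φ 0` and `Φ (2πi)
  -- - M N`. The factor `e^{2iπλ/ε}` cancels `Φ 0` and turns `M 1` into a multiple of `M (N + 1)`.
  · obtain rfl : k = N := by omega
    obtain ⟨K, hK⟩ := exists_add_two_pi_eq (P := fun ξ => Complex.exp (-(l : ℂ) * ξ))
      (fun ξ => by
        have h := Complex.exp_int_mul_two_pi_mul_I (-(l : ℤ))
        push_cast at h
        rw [mul_add, Complex.exp_add, h, mul_one]) hΦ
    have hper := limit_add_eq hN hK hM 1
    have h0 := hK 0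
    rw [zero_add] at h0
    have harc1 := curveIntegrable_form_arc (l := l) hc le_rfl (hpos 1 le_rfl) (hlt 1 hN).le hφ
    have harc2 := curveIntegrable_form_arc (l := l) hc (hpos k h1).le (hlt k le_rfl) le_rfl hφ
    rw [GamPlus, GamMinus, curveIntegral_trans harc1 (hint' 1 le_rfl hN),
      curveIntegral_trans (hint k h1 le_rfl) harc2, hseg k h1 le_rfl, hseg' 1 le_rfl hN,
      curveIntegral_form_arc hc le_rfl (hpos 1 le_rfl) (hlt 1 hN).le hφ hΦ,
      curveIntegral_form_arc hc (hpos k h1).le (hlt k le_rfl) le_rfl hφ hΦ]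
    have he : Complex.exp (2 * π * Complex.I * lam / ε) *
        Complex.exp (-(2 * π * Complex.I * lam / ε)) = 1 := by
      rw [← Complex.exp_add, add_neg_cancel, Complex.exp_zero]
    rw [add_comm (k : ℤ) 1, hper]
    push_cast
    rw [h0, zero_mul]
    linear_combination (Φ 0 - M 1) * he

/-- `F` is a primitive, on `U`, of the integrating factor times
`negPart N b`, and it tends to `0` along the rays. -/
structure IsAdmissible (N : ℕ) (c : ℤ → ℂ) (ε lam : ℝ) (b : Fin N → ℂ) (F : ℂ → ℂ)
    (U : Set ℂ) : Prop where
  hasDerivAt : ∀ ξ ∈ U, HasDerivAt F (weight N c ε lam ξ * negPart N b ξ) ξ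
  tendsto : ∀ k : ℤ, Tendsto (fun s : ℝ => F (s + rayAngle N k * Complex.I)) atBot (𝓝 0)

theorem exists_primitives (hc : IsPotential N c) (hε : 0 < ε) (lam : ℝ) (l : ℕ) :
    ∃ (Φ : ℂ → ℂ) (M : ℤ → ℂ),
      (∀ ξ, HasDerivAt Φ (weight N c ε lam ξ * Complex.exp (-(l : ℂ) * ξ)) ξ) ∧
      ∀ k, Tendsto (fun s : ℝ => Φ (s + rayAngle N k * Complex.I)) atBot (𝓝 (M k)) := by
  obtain ⟨Φ, hΦ⟩ := (differentiable_weight_mul_exp hc ε lam l).isExactOn_univ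
  have h := fun k : ℤ => tendsto_primitive_ray (fun ξ => hΦ ξ (Set.mem_univ _))
    (differentiable_weight_mul_exp hc ε lam l).continuous
    (tendsto_weight_ray hc hε lam l (cos_rayAngle_le hc k))
  exact ⟨Φ, _, fun ξ => hΦ ξ (Set.mem_univ _), h⟩

theorem hasDerivAt_sum_primitives {lam : ℝ} {Φ : Fin N → ℂ → ℂ} (b : Fin N → ℂ)
    (hΦ : ∀ j ξ, HasDerivAt (Φ j) (weight N c ε lam ξ *
      Complex.exp (-((j + 1 : ℕ) : ℂ) * ξ)) ξ) (ξ : ℂ) :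
    HasDerivAt (fun ξ => ∑ j, b j * Φ j ξ) (weight N c ε lam ξ * negPart N b ξ) ξ := by
  refine (HasDerivAt.fun_sum fun j _ => (hΦ j ξ).const_mul (b j)).congr_deriv ?_
  rw [negPart, Finset.mul_sum]
  refine Finset.sum_congr rfl fun j _ => ?_
  push_cast
  ring

theorem det_matrixA_eq_zero_iff_sum (hc : IsPotential N c) (hε : 0 < ε) {lam : ℝ}
    {Φ : Fin N → ℂ → ℂ} {M : Fin N → ℤ → ℂ}
    (hΦ : ∀ j ξ, HasDerivAt (Φ j) (weight N c ε lam ξ *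
      Complex.exp (-((j + 1 : ℕ) : ℂ) * ξ)) ξ)
    (hM : ∀ j k, Tendsto (fun s : ℝ => Φ j (s + rayAngle N k * Complex.I)) atBot (𝓝 (M j k))) :
    (matrixA N c ε lam).det = 0 ↔ ∃ b : Fin N → ℂ, b ≠ 0 ∧ ∀ k : ℕ, 1 ≤ k → k ≤ N →
      ∑ j, b j * M j (k + 1) = ∑ j, b j * M j k := by
  rw [← Matrix.exists_mulVec_eq_zero_iff]
  refine exists_congr fun b => and_congr_right fun _ => ?_
  have hrow (i : Fin N) : (matrixA N c ε lam).mulVec b i =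
      (if (i : ℕ) + 1 < N then 1 else Complex.exp (2 * π * Complex.I * lam / ε)) *
        (∑ j, b j * M j ((((i : ℕ) + 1 : ℕ) : ℤ) + 1) - ∑ j, b j * M j (((i : ℕ) + 1 : ℕ) : ℤ)) := by
    rw [← Finset.sum_sub_distrib, Finset.mul_sum, Matrix.mulVec, dotProduct]
    refine Finset.sum_congr rfl fun j _ => ?_
    rw [matrixA, Matrix.of_apply, coeffA_eq hc hε (hΦ j) (hM j) (by omega) i.2]
    ring
  have hne (i : Fin N) :
      (if (i : ℕ) + 1 < N then 1 else Complex.exp (2 * π * Complex.I * lam / ε)) ≠ 0 := by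
    split_ifs
    · exact one_ne_zero
    · exact Complex.exp_ne_zero _
  constructor
  · intro h k h1 h2
    obtain ⟨i, rfl⟩ : ∃ i, k = i + 1 := ⟨k - 1, by omega⟩
    have h3 := congrFun h ⟨i, h2⟩
    rw [hrow, Pi.zero_apply, mul_eq_zero, or_iff_right (hne _)] at h3
    exact sub_eq_zero.1 h3
  · intro h
    ext i
    rw [hrow, h _ (by omega) i.2, sub_self, mul_zero, Pi.zero_apply]

theorem exists_isAdmissible_of_det_eq_zero (hc : IsPotential N c) (hε : 0 < ε) {lam : ℝ}
    (hdet : (matrixA N c ε lam).det = 0) :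
    ∃ (b : Fin N → ℂ) (F : ℂ → ℂ), b ≠ 0 ∧ IsAdmissible N c ε lam b F Set.univ := by
  choose Φ M hΦ hM using fun j : Fin N => exists_primitives hc hε lam (j + 1)
  obtain ⟨b, hb, hrel⟩ := (det_matrixA_eq_zero_iff_sum hc hε hΦ hM).1 hdet
  have hN := hc.one_le
  set L : ℤ → ℂ := fun k => ∑ j, b j * M j k - ∑ j, b j * M j 1 with hL
  set F : ℂ → ℂ := fun ξ => ∑ j, b j * Φ j ξ - ∑ j, b j * M j 1 with hF
  have hFd : ∀ ξ, HasDerivAt F (weight N c ε lam ξ * negPart N b ξ) ξ := fun ξ =>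
    (hasDerivAt_sum_primitives b hΦ ξ).sub_const _
  have hlim : ∀ k, Tendsto (fun s : ℝ => F (s + rayAngle N k * Complex.I)) atBot (𝓝 (L k)) :=
    fun k => (tendsto_finsetSum _ fun j _ => (hM j k).const_mul (b j)).sub_const _
  obtain ⟨K, hK⟩ := exists_add_two_pi_eq (negPart_add_two_pi N b) hFd
  have hper := limit_add_eq hN hK hlim
  have hsmall : ∀ k : ℕ, k ≤ N → L (k + 1) = 0 := by
    intro k
    induction k with
    | zero => intro _; simp [hL]
    | succ n ih =>
      intro hn
      rw [← ih (by omega)]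
      have := hrel (n + 1) (by omega) hn
      simp only [hL]
      push_cast at this ⊢
      rw [this]
  -- Rays `1` and `N + 1` are the same ray on two consecutive sheets, and the limit is `0` on both.
  have hK0 : K = 0 := by
    have h1 := hper 1
    have h2 := hsmall N le_rfl
    have h3 := hsmall 0 (by omega)
    norm_num at h3
    rw [add_comm, h2, h3] at h1
    simpa using h1.symm
  have hiff : ∀ k, L (k + N) = 0 ↔ L k = 0 := fun k => by
    rw [hper k, hK0, add_zero, mul_eq_zero, or_iff_right (Complex.exp_ne_zero _)]
  have hshift : ∀ k q : ℤ, L k = 0 → L (k + N * q) = 0 := by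
    intro k q hk
    induction q using Int.induction_on with
    | zero => simpa using hk
    | succ i ih =>
      rw [mul_add, mul_one, ← add_assoc]
      exact (hiff _).2 ih
    | pred i ih =>
      refine (hiff _).1 ?_
      rw [add_assoc, mul_sub, mul_one, sub_add_cancel]
      exact ih
  have hall : ∀ k, L k = 0 := by
    intro k
    have hNpos : (0 : ℤ) < N := by exact_mod_cast hN
    have h1 := Int.emod_nonneg (k - 1) hNpos.ne'
    have h2 := Int.emod_lt_of_pos (k - 1) hNpos
    have h3 := Int.emod_add_mul_ediv (k - 1) N
    obtain ⟨r, hr⟩ := Int.eq_ofNat_of_zero_le h1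
    have h4 := hshift (r + 1) ((k - 1) / N) (hsmall r (by omega))
    rwa [show (r : ℤ) + 1 + N * ((k - 1) / N) = k by omega] at h4
  exact ⟨b, F, hb, fun ξ _ => hFd ξ, fun k => by simpa [hall k] using hlim k⟩

/-- A half-plane suffices, since an eigenvector is only known to be holomorphic in the disc. There
`F` differs by a constant from the entire primitive attached to `b`, whose limits on all rays
therefore equal this constant. -/
theorem det_eq_zero_of_isAdmissible (hc : IsPotential N c) (hε : 0 < ε) {lam : ℝ}
    {b : Fin N → ℂ} (hb : b ≠ 0) {F : ℂ → ℂ} (hF : IsAdmissible N c ε lam b F {ξ | ξ.re < 0}) :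
    (matrixA N c ε lam).det = 0 := by
  choose Φ M hΦ hM using fun j : Fin N => exists_primitives hc hε lam (j + 1)
  refine (det_matrixA_eq_zero_iff_sum hc hε hΦ hM).2 ⟨b, hb, ?_⟩
  have hopen : IsOpen {ξ : ℂ | ξ.re < 0} := isOpen_lt Complex.continuous_re continuous_const
  have hconv : Convex ℝ {ξ : ℂ | ξ.re < 0} := convex_halfSpace_re_lt 0
  have hd : ∀ ξ ∈ {ξ : ℂ | ξ.re < 0}, HasDerivAt (fun ξ => ∑ j, b j * Φ j ξ - F ξ) 0 ξ := by
    intro ξ hξ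
    exact ((hasDerivAt_sum_primitives b hΦ ξ).sub (hF.hasDerivAt ξ hξ)).congr_deriv (sub_self _)
  obtain ⟨C, hC⟩ := hopen.exists_is_const_of_deriv_eq_zero hconv.isPreconnected
    (fun ξ hξ => (hd ξ hξ).differentiableAt.differentiableWithinAt) (fun ξ hξ => (hd ξ hξ).deriv)
  have hval : ∀ k, ∑ j, b j * M j k = C := by
    intro k
    have h1 := (tendsto_finsetSum Finset.univ fun j _ => (hM j k).const_mul (b j)).sub
      (hF.tendsto k)
    rw [sub_zero] at h1
    refine tendsto_nhds_unique h1 (tendsto_const_nhds.congr' ?_)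
    filter_upwards [eventually_lt_atBot (0 : ℝ)] with s hs
    exact (hC _ (by simpa using hs)).symm
  intro k _ _
  rw [hval, hval]

end

/-! ### From eigenvectors to admissible primitives -/

/-- The part of negative frequency of the product of the potential with a power series. -/
def tailCoeff (N : ℕ) (c a : ℤ → ℂ) (j : Fin N) : ℂ :=
  ∑ k ∈ Finset.Icc (-(N : ℤ)) (N : ℤ), c k * a (-((j : ℕ) + 1 : ℤ) - k)

/-- The power series with coefficients `a n`, `0 ≤ n`, at `z = e ^ ξ`. -/
def expSeries (a : ℤ → ℂ) (ξ : ℂ) : ℂ := ∑' n : ℕ, a n * Complex.exp (n * ξ)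

theorem norm_exp_nat_mul (n : ℕ) (ξ : ℂ) :
    ‖Complex.exp (n * ξ)‖ = Real.exp ξ.re ^ n := by
  rw [Complex.norm_exp, ← Real.exp_nat_mul]
  simp

section

variable {a : ℤ → ℂ} {C : ℝ}

theorem summable_expSeries (hC : ∀ n, ‖a n‖ ≤ C) {ξ : ℂ} (hξ : ξ.re < 0) :
    Summable fun n : ℕ => a n * Complex.exp (n * ξ) := by
  refine Summable.of_norm_bounded
    ((summable_geometric_of_lt_one (Real.exp_pos _).le (Real.exp_lt_one_iff.2 hξ)).mul_left C)
    fun n => ?_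
  rw [norm_mul, norm_exp_nat_mul]
  gcongr
  exact hC n

theorem summable_mul_expSeries (hC : ∀ n, ‖a n‖ ≤ C) {ξ : ℂ} (hξ : ξ.re < 0) :
    Summable fun n : ℕ => a n * n * Complex.exp (n * ξ) := by
  have hr : ‖Real.exp ξ.re‖ < 1 := by
    rw [Real.norm_of_nonneg (Real.exp_pos _).le]; exact Real.exp_lt_one_iff.2 hξ
  refine Summable.of_norm_bounded
    ((summable_pow_mul_geometric_of_norm_lt_one 1 hr).mul_left C) fun n => ?_
  rw [norm_mul, norm_mul, norm_exp_nat_mul, Complex.norm_natCast, pow_one, mul_assoc]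
  gcongr
  exact hC n

theorem hasDerivAt_expSeries (hC : ∀ n, ‖a n‖ ≤ C) {ξ : ℂ} (hξ : ξ.re < 0) :
    HasDerivAt (expSeries a) (∑' n : ℕ, a n * n * Complex.exp (n * ξ)) ξ := by
  -- On `Re ξ < δ` the differentiated terms have a common summable majorant.
  set δ := ξ.re / 2 with hδ
  have hδ0 : δ < 0 := by rw [hδ]; linarith
  have hr : ‖Real.exp δ‖ < 1 := by
    rw [Real.norm_of_nonneg (Real.exp_pos _).le]; exact Real.exp_lt_one_iff.2 hδ0
  refine hasDerivAt_tsum_of_isPreconnected (t := {ξ : ℂ | ξ.re < δ}) (y₀ := ξ)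
    ((summable_pow_mul_geometric_of_norm_lt_one 1 hr).mul_left C)
    (isOpen_lt Complex.continuous_re continuous_const) (convex_halfSpace_re_lt δ).isPreconnected
    (g := fun (n : ℕ) ξ => a n * Complex.exp (n * ξ))
    (g' := fun (n : ℕ) ξ => a n * n * Complex.exp (n * ξ)) ?_ ?_ ?_ ?_ ?_
  · intro n y _
    have h := (((hasDerivAt_id y).const_mul (n : ℂ)).cexp).const_mul (a n)
    refine h.congr_deriv ?_
    simp only [id]
    ring
  · intro n y (hy : y.re < δ)
    rw [norm_mul, norm_mul, norm_exp_nat_mul, Complex.norm_natCast, pow_one, mul_assoc]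
    have hC0 := (norm_nonneg _).trans (hC n)
    gcongr
    exact hC n
  · change ξ.re < δ; rw [hδ]; linarith
  · exact summable_expSeries hC hξ
  · change ξ.re < δ; rw [hδ]; linarith

theorem norm_expSeries_le (hC : ∀ n, ‖a n‖ ≤ C) {ξ : ℂ} (hξ : ξ.re ≤ -1) :
    ‖expSeries a ξ‖ ≤ C * (1 - Real.exp (-1))⁻¹ := by
  have hr : Real.exp (-1) < 1 := Real.exp_lt_one_iff.2 (by norm_num)
  refine tsum_of_norm_bounded
    ((hasSum_geometric_of_lt_one (Real.exp_pos _).le hr).mul_left C) fun n => ?_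
  rw [norm_mul, norm_exp_nat_mul]
  have hC0 := (norm_nonneg _).trans (hC n)
  gcongr
  exact hC n

theorem hasSum_int_of_nat {f : ℤ → ℂ} (hf : ∀ n < 0, f n = 0) {S : ℂ}
    (h : HasSum (fun n : ℕ => f n) S) : HasSum f S := by
  refine (Function.Injective.hasSum_iff Nat.cast_injective fun n hn => ?_).1 h
  refine hf n ?_
  by_contra hn'
  exact hn ⟨n.toNat, by omega⟩

theorem hasSum_laurent_mul (N : ℕ) (c : ℤ → ℂ) {ξ S : ℂ}
    (h : HasSum (fun n : ℤ => a n * Complex.exp (n * ξ)) S) :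
    HasSum (fun n : ℤ =>
      (∑ k ∈ Finset.Icc (-(N : ℤ)) (N : ℤ), c k * a (n - k)) * Complex.exp (n * ξ))
      (laurent N c ξ * S) := by
  simp only [laurent, Finset.sum_mul]
  refine hasSum_sum fun k _ => ?_
  have h1 := ((Equiv.subRight k).hasSum_iff (a := S)).2 h
  have h2 := h1.mul_left (c k * Complex.exp (k * ξ))
  refine h2.congr_fun fun n => ?_
  simp only [Function.comp, Equiv.subRight_apply]
  rw [show ((n : ℂ)) * ξ = k * ξ + ((n - k : ℤ) : ℂ) * ξ by push_cast; ring, Complex.exp_add]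
  ring

end

/-! ### Eigenvectors and the differential equation in the disc -/

section

variable {N : ℕ} {c a : ℤ → ℂ} {ε lam : ℝ}

theorem IsEigenSeq.exists_norm_le (h : IsEigenSeq N c ε lam a) : ∃ C : ℝ, ∀ n, ‖a n‖ ≤ C :=
  ⟨_, fun n => lp.norm_apply_le_norm two_ne_zero (⟨a, h.memℓp⟩ : lp (fun _ : ℤ => ℂ) 2) n⟩

theorem IsEigenSeq.tailCoeff_ne_zero (hc : IsPotential N c) (h : IsEigenSeq N c ε lam a) :
    tailCoeff N c a ≠ 0 := by
  intro hb
  have hrec : ∀ n : ℤ, -(N : ℤ) ≤ n →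
      ε * n * a n - ∑ k ∈ Finset.Icc (-(N : ℤ)) (N : ℤ), c k * a (n - k) = lam * a n := by
    intro n hn
    rcases lt_or_ge n 0 with hn0 | hn0
    · have h1 := congrFun hb ⟨(-n - 1).toNat, by omega⟩
      have h2 : -(((-n - 1).toNat : ℤ) + 1) = n := by omega
      simp only [tailCoeff, h2, Pi.zero_apply] at h1
      rw [h1, h.eq_zero n hn0]
      simp
    · exact h.recurrence n hn0
  have hall : ∀ m : ℕ, a m = 0 := by
    intro m
    induction m using Nat.strong_induction_on with
    | _ m ih =>
      have hlt : ∀ n : ℤ, n < m → a n = 0 := by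
        intro n hn
        rcases lt_or_ge n 0 with hn0 | hn0
        · exact h.eq_zero n hn0
        · obtain ⟨r, rfl⟩ := Int.eq_ofNat_of_zero_le hn0
          exact ih r (by exact_mod_cast hn)
      -- At the frequency `m - N` only the term `k = -N` of the convolution, that is `c (-N) * a m`,
      -- is not known to vanish.
      have h1 := hrec (m - N) (by omega)
      have hN := hc.one_le
      rw [hlt (m - N) (by omega), Finset.sum_eq_single_of_mem (-(N : ℤ)) (by simp)] at h1
      · simp only [mul_zero, zero_sub, neg_eq_zero, mul_eq_zero, hc.bot_ne_zero, false_or] at h1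
        rwa [sub_neg_eq_add, sub_add_cancel] at h1
      · intro k hk hk'
        rw [Finset.mem_Icc] at hk
        rw [hlt _ (by omega), mul_zero]
  refine h.ne_zero (funext fun n => ?_)
  rcases lt_or_ge n 0 with hn0 | hn0
  · exact h.eq_zero n hn0
  · obtain ⟨r, rfl⟩ := Int.eq_ofNat_of_zero_le hn0
    exact hall r

/-- Comparison of coefficients: the recurrence cancels all `n ≥ 0`, there is nothing below `-N`, and
the remaining frequencies are the tail by definition. -/
theorem IsEigenSeq.expSeries_eq (h : IsEigenSeq N c ε lam a) {ξ : ℂ} (hξ : ξ.re < 0) :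
    ε * ∑' n : ℕ, a n * n * Complex.exp (n * ξ) =
      (laurent N c ξ + lam) * expSeries a ξ - negPart N (tailCoeff N c a) ξ := by
  obtain ⟨C, hC⟩ := h.exists_norm_le
  have h1 : HasSum (fun n : ℤ => a n * Complex.exp (n * ξ)) (expSeries a ξ) :=
    hasSum_int_of_nat (fun n hn => by rw [h.eq_zero n hn, zero_mul])
      (by simpa [expSeries] using (summable_expSeries hC hξ).hasSum)
  have h2 : HasSum (fun n : ℤ => a n * n * Complex.exp (n * ξ))
      (∑' n : ℕ, a n * n * Complex.exp (n * ξ)) :=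
    hasSum_int_of_nat (fun n hn => by rw [h.eq_zero n hn, zero_mul, zero_mul])
      (by simpa using (summable_mul_expSeries hC hξ).hasSum)
  have h3 := ((hasSum_laurent_mul N c h1).add (h1.mul_left (lam : ℂ))).sub (h2.mul_left (ε : ℂ))
  have h4 : HasSum (fun n : ℤ =>
      (∑ k ∈ Finset.Icc (-(N : ℤ)) (N : ℤ), c k * a (n - k)) * Complex.exp (n * ξ) +
        lam * (a n * Complex.exp (n * ξ)) - ε * (a n * n * Complex.exp (n * ξ)))
      (negPart N (tailCoeff N c a) ξ) := by
    have hinj : Function.Injective fun j : Fin N => -((j : ℕ) + 1 : ℤ) := by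
      intro i j hij
      simp only [neg_inj, add_left_inj, Nat.cast_inj] at hij
      exact Fin.ext hij
    refine (hinj.hasSum_iff fun n hn => ?_).1 ?_
    · rcases lt_or_ge n 0 with hn0 | hn0
      · have hnN : n < -(N : ℤ) := by
          by_contra hcon
          exact hn ⟨⟨(-n - 1).toNat, by omega⟩, by simp; omega⟩
        rw [h.eq_zero n hn0, Finset.sum_eq_zero]
        · simp
        · intro k hk
          rw [Finset.mem_Icc] at hk
          rw [h.eq_zero _ (by omega), mul_zero]
      · have := h.recurrence n hn0
        linear_combination (-Complex.exp (n * ξ)) * this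
    · rw [negPart]
      convert hasSum_fintype _ using 1
      refine Finset.sum_congr rfl fun j _ => ?_
      simp only [Function.comp, tailCoeff]
      rw [h.eq_zero (-((j : ℕ) + 1 : ℤ)) (by omega)]
      push_cast
      ring
  linear_combination h4.unique h3

theorem IsEigenSeq.exists_isAdmissible (hc : IsPotential N c) (hε : 0 < ε)
    (h : IsEigenSeq N c ε lam a) :
    IsAdmissible N c ε lam (tailCoeff N c a)
      (fun ξ => -ε * (weight N c ε lam ξ * expSeries a ξ)) {ξ | ξ.re < 0} := by
  obtain ⟨C, hC⟩ := h.exists_norm_le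
  have hεC : (ε : ℂ) ≠ 0 := by exact_mod_cast hε.ne'
  refine ⟨fun ξ hξ => ?_, fun k => ?_⟩
  · refine (((hasDerivAt_weight hc.zero ε lam ξ).mul
      (hasDerivAt_expSeries hC hξ)).const_mul (-ε : ℂ)).congr_deriv ?_
    have h1 := h.expSeries_eq hξ
    field_simp
    linear_combination (-weight N c ε lam ξ) * h1
  · have h1 := tendsto_weight_ray_zero hc hε lam (cos_rayAngle_le hc k)
    have h2 : Tendsto (fun s : ℝ => weight N c ε lam (s + rayAngle N k * Complex.I) *
        expSeries a (s + rayAngle N k * Complex.I)) atBot (𝓝 0) := by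
      refine h1.zero_mul_isBoundedUnder_le ⟨C * (1 - Real.exp (-1))⁻¹, ?_⟩
      rw [eventually_map]
      filter_upwards [eventually_le_atBot (-1 : ℝ)] with s hs
      exact norm_expSeries_le hC (by simpa using hs)
    simpa using h2.const_mul (-ε : ℂ)

end

/-! ### Boundedness near the origin -/

section

variable {N : ℕ} {c : ℤ → ℂ} {ε lam : ℝ} {b : Fin N → ℂ} {F : ℂ → ℂ}

theorem hasDerivAt_line (ξ d : ℂ) (t : ℝ) : HasDerivAt (fun t : ℝ => ξ + t * d) d t := by
  simpa using ((hasDerivAt_id t).ofReal_comp.mul_const d).const_add ξ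

theorem hasDerivAt_norm_weight (hc0 : c 0 = 0) (ε lam : ℝ) (ξ d : ℂ) (t : ℝ) :
    HasDerivAt (fun t : ℝ => ‖weight N c ε lam (ξ + t * d)‖)
      ((-(laurent N c (ξ + t * d) + lam) / ε * d).re * ‖weight N c ε lam (ξ + t * d)‖) t := by
  simp only [weight, Complex.norm_exp]
  have h1 : HasDerivAt (fun t : ℝ => (-(laurent N (fun k => c k / k) (ξ + t * d)) / ε -
      lam / ε * (ξ + t * d))) (-(laurent N c (ξ + t * d) + lam) / ε * d) t :=
    (hasDerivAt_logWeight hc0 ε lam (ξ + t * d)).comp_of_eq t (hasDerivAt_line ξ d t) rfl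
  have h2 := (Complex.reCLM.hasFDerivAt.comp_hasDerivAt t h1).exp
  exact h2.congr_deriv (mul_comm _ _)

/-- Along a line on which the modulus of the integrating factor increases fast enough, the
quotient of a primitive by the integrating factor stays bounded. -/
theorem norm_le_mul_norm_weight (hc0 : c 0 = 0)
    (hF : ∀ ξ, HasDerivAt F (weight N c ε lam ξ * negPart N b ξ) ξ) {C : ℝ} {ξ d : ℂ} {T : ℝ}
    (hT : 0 ≤ T) (hd : ‖d‖ = 1)
    (hC : ∀ t ∈ Set.Ico 0 T, ‖negPart N b (ξ + t * d)‖ ≤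
      C * (-(laurent N c (ξ + t * d) + lam) / ε * d).re) :
    ‖F (ξ + T * d)‖ ≤
      ‖F ξ‖ + C * (‖weight N c ε lam (ξ + T * d)‖ - ‖weight N c ε lam ξ‖) := by
  have hf : ∀ t : ℝ, HasDerivAt (fun t : ℝ => F (ξ + t * d))
      (weight N c ε lam (ξ + t * d) * negPart N b (ξ + t * d) * d) t := fun t =>
    (hF (ξ + t * d)).comp_of_eq t (hasDerivAt_line ξ d t) rfl
  have hB : ∀ t : ℝ, HasDerivAt (fun t : ℝ => ‖F ξ‖ +
      C * (‖weight N c ε lam (ξ + t * d)‖ - ‖weight N c ε lam ξ‖))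
      (C * ((-(laurent N c (ξ + t * d) + lam) / ε * d).re * ‖weight N c ε lam (ξ + t * d)‖)) t :=
    fun t => (((hasDerivAt_norm_weight hc0 ε lam ξ d t).sub_const _).const_mul C).const_add _
  refine image_norm_le_of_norm_deriv_right_le_deriv_boundary (a := 0) (b := T)
    (f := fun t : ℝ => F (ξ + t * d)) (fun t _ => (hf t).continuousAt.continuousWithinAt)
    (fun t _ => (hf t).hasDerivWithinAt) ?_ hB ?_ (Set.right_mem_Icc.2 hT)
  · simp
  · intro t ht
    rw [norm_mul, norm_mul, hd, mul_one, mul_comm, ← mul_assoc]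
    gcongr
    exact hC t ht

/-- The decay spreads from a ray to the sector where `cos (Nθ) ≤ -1/2`: on the arc joining `θ` to
the ray, `F'` is uniformly small, because the decay of the weight beats the growth `e^{-Ns}` of
`negPart N b`. -/
theorem IsAdmissible.tendsto_zero (hc : IsPotential N c) (hε : 0 < ε)
    (hF : IsAdmissible N c ε lam b F Set.univ) (k : ℤ) {θ : ℝ}
    (hθ : |N * (θ - rayAngle N k)| ≤ π / 3) :
    Tendsto (fun s : ℝ => F (s + θ * Complex.I)) atBot (𝓝 0) := by
  have hN0 : (0 : ℝ) < N := by exact_mod_cast hc.one_le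
  obtain ⟨B, hB, hBle⟩ := exists_norm_weight_le hc hε lam N
  obtain ⟨D, hD0, hD⟩ := exists_norm_negPart_le N b
  have hdiff : Tendsto (fun s : ℝ => F (s + θ * Complex.I) - F (s + rayAngle N k * Complex.I))
      atBot (𝓝 0) := by
    have hlim : Tendsto (fun s => D * B s * |θ - rayAngle N k|) atBot (𝓝 0) := by
      simpa using (hB.const_mul D).mul_const |θ - rayAngle N k|
    refine squeeze_zero_norm' ?_ hlim
    filter_upwards [hBle, eventually_le_atBot (0 : ℝ)] with s hs hs0
    have hder : ∀ x ∈ Set.uIcc (rayAngle N k) θ,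
        HasDerivWithinAt (fun x : ℝ => F (s + x * Complex.I))
          (weight N c ε lam (s + x * Complex.I) * negPart N b (s + x * Complex.I) * Complex.I)
          (Set.uIcc (rayAngle N k) θ) x := fun x _ =>
      ((hF.hasDerivAt _ (Set.mem_univ _)).comp_of_eq x
        (hasDerivAt_line s Complex.I x) rfl).hasDerivWithinAt
    refine (convex_uIcc _ _).norm_image_sub_le_of_norm_hasDerivWithin_le hder ?_
      Set.left_mem_uIcc Set.right_mem_uIcc
    intro x hx
    have hx1 : |N * (x - rayAngle N k)| ≤ π / 3 := by
      refine le_trans ?_ hθ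
      rw [abs_mul, abs_mul]
      gcongr ?_ * ?_
      exact Set.abs_sub_left_of_mem_uIcc hx
    have hcos : Real.cos (N * x) ≤ -(1 / 2) := by
      rw [show N * x = N * (x - rayAngle N k) + N * rayAngle N k by ring, mul_rayAngle hc.one_le,
        ← add_sub_assoc, Real.cos_sub_pi, Real.cos_add_int_mul_two_pi, ← Real.cos_abs]
      have h := Real.cos_le_cos_of_nonneg_of_le_pi (abs_nonneg _) (by linarith [Real.pi_pos]) hx1
      rw [Real.cos_pi_div_three] at h
      linarith
    have h1 := hs x hcos
    have h2 := hD (s + x * Complex.I) (by simpa using hs0)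
    rw [norm_mul, norm_mul, Complex.norm_I, mul_one]
    calc _ ≤ ‖weight N c ε lam (s + x * Complex.I)‖ * (D * Real.exp (-(N : ℝ) * s)) := by
          gcongr
          simpa using h2
      _ = D * (‖weight N c ε lam (s + x * Complex.I)‖ * Real.exp (-(N : ℝ) * s)) := by ring
      _ ≤ D * B s := by gcongr
  simpa using hdiff.add (hF.tendsto k)

theorem IsAdmissible.add_two_pi (hc : IsPotential N c)
    (hF : IsAdmissible N c ε lam b F Set.univ) (ξ : ℂ) :
    F (ξ + 2 * π * Complex.I) = Complex.exp (-(2 * π * Complex.I * lam / ε)) * F ξ := by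
  obtain ⟨K, hK⟩ := exists_add_two_pi_eq (negPart_add_two_pi N b)
    (fun ξ => hF.hasDerivAt ξ (Set.mem_univ _))
  have h := limit_add_eq hc.one_le hK (M := fun _ => 0) hF.tendsto 0
  rw [mul_zero, zero_add] at h
  rw [hK, ← h, add_zero]

theorem exp_neg_mul_I_re (N : ℕ) (x : ℝ) :
    (Complex.exp (-(N : ℂ) * x * Complex.I)).re = Real.cos (N * x) := by
  rw [show -(N : ℂ) * x * Complex.I = ((-(N * x) : ℝ) : ℂ) * Complex.I by push_cast; ring,
    Complex.exp_ofReal_mul_I_re, Real.cos_neg]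

theorem exp_neg_mul_I_im (N : ℕ) (x : ℝ) :
    (Complex.exp (-(N : ℂ) * x * Complex.I)).im = -Real.sin (N * x) := by
  rw [show -(N : ℂ) * x * Complex.I = ((-(N * x) : ℝ) : ℂ) * Complex.I by push_cast; ring,
    Complex.exp_ofReal_mul_I_im, Real.sin_neg]

/-- The quotient of an admissible primitive by the integrating factor. -/
def quot (N : ℕ) (c : ℤ → ℂ) (ε lam : ℝ) (F : ℂ → ℂ) (ξ : ℂ) : ℂ := F ξ / weight N c ε lam ξ

theorem IsAdmissible.quot_add_two_pi (hc : IsPotential N c)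
    (hF : IsAdmissible N c ε lam b F Set.univ) (ξ : ℂ) :
    quot N c ε lam F (ξ + 2 * π * Complex.I) = quot N c ε lam F ξ := by
  rw [quot, hF.add_two_pi hc, weight_add_two_pi,
    mul_div_mul_left _ _ (Complex.exp_ne_zero _), quot]

theorem IsAdmissible.hasDerivAt_quot (hc : IsPotential N c) (hε : 0 < ε)
    (hF : IsAdmissible N c ε lam b F Set.univ) (ξ : ℂ) :
    HasDerivAt (quot N c ε lam F)
      (negPart N b ξ + (laurent N c ξ + lam) / ε * quot N c ε lam F ξ) ξ := by
  have hw := weight_ne_zero N c ε lam ξ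
  have hεC : (ε : ℂ) ≠ 0 := by exact_mod_cast hε.ne'
  refine ((hF.hasDerivAt ξ (Set.mem_univ _)).div (hasDerivAt_weight hc.zero ε lam ξ)
    hw).congr_deriv ?_
  rw [quot]
  field_simp
  ring

/-- Let `φ = N (θ - θ_k)` be the phase relative to a ray. According to `φ`, a unit direction `1`,
`±i` or `-1` makes `|w|` increase at a rate that dominates `negPart N b`, and integration of `F'` in
that direction propagates `‖F‖ ≤ C ‖w‖`. The starting points are the origin, where `F → 0`, for `|φ|
≤ π/3`; the edges of this sector for `π/3 ≤ |φ| ≤ 2π/3`; and a fixed circle for `|φ - π| ≤ π/3`. -/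
theorem IsAdmissible.exists_norm_quot_le (hc : IsPotential N c) (hε : 0 < ε)
    (hF : IsAdmissible N c ε lam b F Set.univ) :
    ∃ s₀ C : ℝ, ∀ ξ : ℂ, ξ.re ≤ s₀ → ‖quot N c ε lam F ξ‖ ≤ C := by
  have hN0 : (0 : ℝ) < N := by exact_mod_cast hc.one_le
  have hFd := fun ξ => hF.hasDerivAt ξ (Set.mem_univ _)
  obtain ⟨s₀, hs₀, C₁, hC₁, hkey⟩ := exists_norm_negPart_le_re hc hε lam b
  -- Bound on the fixed circle, by periodicity and compactness; it starts the inward propagation.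
  obtain ⟨C₂, hC₂⟩ : ∃ C₂, ∀ θ : ℝ, ‖quot N c ε lam F (s₀ + θ * Complex.I)‖ ≤ C₂ := by
    have hcont : Continuous fun θ : ℝ => quot N c ε lam F (s₀ + θ * Complex.I) :=
      (continuous_iff_continuousAt.2 fun ξ => (hF.hasDerivAt_quot hc hε ξ).continuousAt).comp
        (by fun_prop)
    have hper : Function.Periodic (fun θ : ℝ => quot N c ε lam F (s₀ + θ * Complex.I))
        (2 * π) := fun θ => by
      refine (congrArg (quot N c ε lam F) ?_).trans (hF.quot_add_two_pi hc _)
      push_cast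
      ring
    obtain ⟨C, hC⟩ := (hper.isBounded_of_continuous Real.two_pi_pos.ne' hcont).exists_norm_le
    exact ⟨C, fun θ => hC _ ⟨θ, rfl⟩⟩
  set C := max C₁ C₂ with hCdef
  have hmono : ∀ (s θ : ℝ) (d : ℂ) (T : ℝ), 0 ≤ T → ‖d‖ = 1 →
      (∀ t ∈ Set.Ico 0 T, ((s : ℂ) + θ * Complex.I + t * d).re ≤ s₀ ∧
        (Complex.exp (-(N : ℂ) * ((s : ℂ) + θ * Complex.I + t * d).im * Complex.I) * d).re ≤
          -(1 / 2)) →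
      ‖F (s + θ * Complex.I + T * d)‖ ≤ ‖F (s + θ * Complex.I)‖ +
        C * (‖weight N c ε lam (s + θ * Complex.I + T * d)‖ -
          ‖weight N c ε lam (s + θ * Complex.I)‖) := by
    intro s θ d T hT hd h
    refine norm_le_mul_norm_weight hc.zero hFd hT hd fun t ht => ?_
    obtain ⟨h1, h2⟩ := hkey d _ hd (h t ht).1 (h t ht).2
    exact h2.trans (mul_le_mul_of_nonneg_right (le_max_left _ _) h1)
  have hphase : ∀ (k : ℤ) (φ : ℝ), Real.cos (N * (rayAngle N k + φ / N)) = -Real.cos φ ∧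
      Real.sin (N * (rayAngle N k + φ / N)) = -Real.sin φ := by
    intro k φ
    have : N * (rayAngle N k + φ / N) = φ + k * (2 * π) - π := by
      rw [mul_add, mul_rayAngle hc.one_le]; field_simp; ring
    rw [this, Real.cos_sub_pi, Real.sin_sub_pi, Real.cos_add_int_mul_two_pi,
      Real.sin_add_int_mul_two_pi]
    exact ⟨rfl, rfl⟩
  -- the sectors around the rays: outwards, from the origin
  have hsector : ∀ (k : ℤ) (φ s : ℝ), |φ| ≤ π / 3 → s ≤ s₀ →
      ‖F (s + (rayAngle N k + φ / N : ℝ) * Complex.I)‖ ≤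
        C * ‖weight N c ε lam (s + (rayAngle N k + φ / N : ℝ) * Complex.I)‖ := by
    intro k φ s hφ hs
    set θ := rayAngle N k + φ / N with hθ
    have hlim := hF.tendsto_zero hc hε k (θ := θ) (by
      rw [hθ, add_sub_cancel_left, mul_div_cancel₀ _ hN0.ne']; exact hφ)
    have hlim' : Tendsto (fun r : ℝ => ‖F (r + θ * Complex.I)‖ +
        C * ‖weight N c ε lam (s + θ * Complex.I)‖) atBot
        (𝓝 (C * ‖weight N c ε lam (s + θ * Complex.I)‖)) := by
      simpa using hlim.norm.add_const (C * ‖weight N c ε lam (s + θ * Complex.I)‖)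
    refine ge_of_tendsto hlim' ?_
    filter_upwards [eventually_le_atBot s] with r hr
    have h := hmono r θ 1 (s - r) (by linarith) (by simp) (by
      intro t ht
      constructor
      · simp; linarith [ht.2]
      · rw [mul_one, show ((r : ℂ) + θ * Complex.I + t * 1).im = θ by simp, exp_neg_mul_I_re,
          (hphase k φ).1, ← Real.cos_abs]
        have h := Real.cos_le_cos_of_nonneg_of_le_pi (abs_nonneg _) (by linarith [Real.pi_pos]) hφ
        rw [Real.cos_pi_div_three] at h
        linarith)
    rw [show (r : ℂ) + θ * Complex.I + (s - r : ℝ) * 1 = s + θ * Complex.I by push_cast; ring] at h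
    refine h.trans ?_
    have hpos : 0 ≤ C * ‖weight N c ε lam (r + θ * Complex.I)‖ :=
      mul_nonneg (hC₁.trans (le_max_left _ _)) (norm_nonneg _)
    linarith
  have hsin : ∀ φ : ℝ, π / 3 ≤ φ → φ ≤ 2 * π / 3 → 1 / 2 ≤ Real.sin φ := by
    intro φ h1 h2
    rw [← Real.cos_sub_pi_div_two, ← Real.cos_abs, ← Real.cos_pi_div_three]
    refine Real.cos_le_cos_of_nonneg_of_le_pi (abs_nonneg _) (by linarith [Real.pi_pos]) ?_
    rw [abs_le]
    constructor <;> linarith [Real.pi_pos]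
  -- the intermediate sectors: along circles, from the boundary of the previous sectors
  have hupper : ∀ (k : ℤ) (φ s : ℝ), π / 3 ≤ φ → φ ≤ 2 * π / 3 → s ≤ s₀ →
      ‖F (s + (rayAngle N k + φ / N : ℝ) * Complex.I)‖ ≤
        C * ‖weight N c ε lam (s + (rayAngle N k + φ / N : ℝ) * Complex.I)‖ := by
    intro k φ s h1 h2 hs
    have h0 := hsector k (π / 3) s (by rw [abs_of_pos]; positivity) hs
    have h := hmono s (rayAngle N k + π / 3 / N) Complex.I ((φ - π / 3) / N)
      (div_nonneg (by linarith) hN0.le) (by simp) (by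
      intro t ht
      constructor
      · simpa using hs
      · have ht2 : t * N < φ - π / 3 := (lt_div_iff₀ hN0).1 ht.2
        have ht1 : 0 ≤ t * N := mul_nonneg ht.1 hN0.le
        rw [show ((s : ℂ) + (rayAngle N k + π / 3 / N : ℝ) * Complex.I + t * Complex.I).im =
          rayAngle N k + (π / 3 + t * N) / N by simp; field_simp; ring, Complex.mul_I_re,
          exp_neg_mul_I_im, (hphase k _).2]
        have := hsin (π / 3 + t * N) (by linarith) (by linarith)
        linarith)
    rw [show (s : ℂ) + (rayAngle N k + π / 3 / N : ℝ) * Complex.I +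
      ((φ - π / 3) / N : ℝ) * Complex.I = s + (rayAngle N k + φ / N : ℝ) * Complex.I by
        push_cast; ring] at h
    linarith
  have hlower : ∀ (k : ℤ) (φ s : ℝ), -(2 * π / 3) ≤ φ → φ ≤ -(π / 3) → s ≤ s₀ →
      ‖F (s + (rayAngle N k + φ / N : ℝ) * Complex.I)‖ ≤
        C * ‖weight N c ε lam (s + (rayAngle N k + φ / N : ℝ) * Complex.I)‖ := by
    intro k φ s h1 h2 hs
    have h0 := hsector k (-(π / 3)) s (by rw [abs_neg, abs_of_pos]; positivity) hs
    have h := hmono s (rayAngle N k + -(π / 3) / N) (-Complex.I) ((-(π / 3) - φ) / N)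
      (div_nonneg (by linarith) hN0.le) (by simp) (by
      intro t ht
      constructor
      · simpa using hs
      · have ht2 : t * N < -(π / 3) - φ := (lt_div_iff₀ hN0).1 ht.2
        have ht1 : 0 ≤ t * N := mul_nonneg ht.1 hN0.le
        rw [show ((s : ℂ) + (rayAngle N k + -(π / 3) / N : ℝ) * Complex.I + t * -Complex.I).im =
          rayAngle N k + (-(π / 3 + t * N)) / N by simp; field_simp; ring, mul_neg, Complex.neg_re,
          Complex.mul_I_re, exp_neg_mul_I_im, (hphase k _).2, Real.sin_neg]
        have := hsin (π / 3 + t * N) (by linarith) (by linarith)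
        linarith)
    rw [show (s : ℂ) + (rayAngle N k + -(π / 3) / N : ℝ) * Complex.I +
      ((-(π / 3) - φ) / N : ℝ) * -Complex.I = s + (rayAngle N k + φ / N : ℝ) * Complex.I by
        push_cast; ring] at h
    linarith
  -- the opposite sectors: inwards, from a fixed circle
  have hopp : ∀ (k : ℤ) (φ s : ℝ), |φ - π| ≤ π / 3 → s ≤ s₀ →
      ‖F (s + (rayAngle N k + φ / N : ℝ) * Complex.I)‖ ≤
        C * ‖weight N c ε lam (s + (rayAngle N k + φ / N : ℝ) * Complex.I)‖ := by
    intro k φ s hφ hs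
    set θ := rayAngle N k + φ / N with hθ
    have h0 : ‖F (s₀ + θ * Complex.I)‖ ≤ C * ‖weight N c ε lam (s₀ + θ * Complex.I)‖ := by
      have h := (hC₂ θ).trans (le_max_right C₁ C₂)
      rwa [quot, norm_div, div_le_iff₀ (norm_pos_iff.2 (weight_ne_zero _ _ _ _ _))] at h
    have h := hmono s₀ θ (-1) (s₀ - s) (by linarith) (by simp) (by
      intro t ht
      constructor
      · simpa using ht.1
      · rw [mul_neg_one, Complex.neg_re,
          show ((s₀ : ℂ) + θ * Complex.I + t * -1).im = θ by simp, exp_neg_mul_I_re,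
          (hphase k φ).1, neg_neg, ← neg_neg (Real.cos φ), ← Real.cos_sub_pi, ← Real.cos_abs]
        have h := Real.cos_le_cos_of_nonneg_of_le_pi (abs_nonneg _) (by linarith [Real.pi_pos]) hφ
        rw [Real.cos_pi_div_three] at h
        linarith)
    rw [show (s₀ : ℂ) + θ * Complex.I + (s₀ - s : ℝ) * -1 = s + θ * Complex.I by
      push_cast; ring] at h
    linarith
  refine ⟨s₀, C, fun ξ hξ => ?_⟩
  rw [quot, norm_div, div_le_iff₀ (norm_pos_iff.2 (weight_ne_zero _ _ _ _ _))]
  -- This choice of `k` puts the phase `φ` in `[-2π/3, 4π/3)`, the union of the four sectors.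
  set k : ℤ := ⌊(N * ξ.im + π + 2 * π / 3) / (2 * π)⌋ with hk
  set φ : ℝ := N * (ξ.im - rayAngle N k) with hφ
  have hξ' : ξ = (ξ.re : ℂ) + (rayAngle N k + φ / N : ℝ) * Complex.I := by
    rw [hφ, mul_div_cancel_left₀ _ hN0.ne', add_sub_cancel, Complex.re_add_im]
  have h1 := (le_div_iff₀ Real.two_pi_pos).1 (Int.floor_le ((N * ξ.im + π + 2 * π / 3) / (2 * π)))
  have h2 := (div_lt_iff₀ Real.two_pi_pos).1
    (Int.lt_floor_add_one ((N * ξ.im + π + 2 * π / 3) / (2 * π)))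
  rw [← hk] at h1 h2
  have h3 : φ = N * ξ.im - k * (2 * π) + π := by rw [hφ, mul_sub, mul_rayAngle hc.one_le]; ring
  rw [hξ']
  have hpi := Real.pi_pos
  rcases le_or_gt φ (-(π / 3)) with h4 | h4
  · exact hlower k φ _ (by linarith) h4 hξ
  rcases le_or_gt φ (π / 3) with h5 | h5
  · exact hsector k φ _ (abs_le.2 ⟨h4.le, h5⟩) hξ
  rcases le_or_gt φ (2 * π / 3) with h6 | h6
  · exact hupper k φ _ h5.le h6 hξ
  · exact hopp k φ _ (abs_le.2 ⟨by linarith, by linarith⟩) hξ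

end

/-! ### Fourier coefficients on the unit circle -/

/-- The `n`-th Fourier coefficient of `θ ↦ g (i θ)` on `[0, 2π]`. -/
def circCoeff (g : ℂ → ℂ) (n : ℤ) : ℂ :=
  (1 / (2 * π)) * ∫ θ in (0 : ℝ)..2 * π, g (θ * Complex.I) * Complex.exp (-(n : ℂ) * (θ * Complex.I))

theorem intervalIntegrable_circCoeff {g : ℂ → ℂ} (hg : Continuous g) (n : ℤ) :
    IntervalIntegrable (fun θ : ℝ => g (θ * Complex.I) *
      Complex.exp (-(n : ℂ) * (θ * Complex.I))) volume 0 (2 * π) :=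
  ((hg.comp (by fun_prop : Continuous fun θ : ℝ => (θ : ℂ) * Complex.I)).mul
    (by fun_prop)).intervalIntegrable _ _

theorem circCoeff_add {g h : ℂ → ℂ} (hg : Continuous g) (hh : Continuous h) (n : ℤ) :
    circCoeff (fun ξ => g ξ + h ξ) n = circCoeff g n + circCoeff h n := by
  simp only [circCoeff, add_mul]
  rw [intervalIntegral.integral_add (intervalIntegrable_circCoeff hg n)
    (intervalIntegrable_circCoeff hh n), mul_add]

theorem circCoeff_const_mul (a : ℂ) (g : ℂ → ℂ) (n : ℤ) :
    circCoeff (fun ξ => a * g ξ) n = a * circCoeff g n := by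
  simp only [circCoeff, mul_assoc]
  rw [intervalIntegral.integral_const_mul]
  ring

theorem circCoeff_sum {ι : Type*} (s : Finset ι) {g : ι → ℂ → ℂ} (hg : ∀ i ∈ s, Continuous (g i))
    (n : ℤ) : circCoeff (fun ξ => ∑ i ∈ s, g i ξ) n = ∑ i ∈ s, circCoeff (g i) n := by
  simp only [circCoeff, Finset.sum_mul]
  rw [intervalIntegral.integral_finsetSum fun i hi => intervalIntegrable_circCoeff (hg i hi) n,
    Finset.mul_sum]

theorem circCoeff_exp_mul (k : ℤ) (g : ℂ → ℂ) (n : ℤ) :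
    circCoeff (fun ξ => Complex.exp (k * ξ) * g ξ) n = circCoeff g (n - k) := by
  simp only [circCoeff]
  congr 2
  ext θ
  rw [mul_comm (Complex.exp _), mul_assoc, ← Complex.exp_add]
  congr 2
  push_cast
  ring

/-- Integration by parts; the boundary terms cancel by periodicity. No factor `i` appears because
the derivative is taken in `ξ = iθ`. -/
theorem circCoeff_deriv {g g' : ℂ → ℂ} (hg : ∀ ξ, HasDerivAt g (g' ξ) ξ) (hg' : Continuous g')
    (hper : ∀ ξ, g (ξ + 2 * π * Complex.I) = g ξ) (n : ℤ) :
    circCoeff g' n = n * circCoeff g n := by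
  have hgc : Continuous g := continuous_iff_continuousAt.2 fun ξ => (hg ξ).continuousAt
  have hder : ∀ θ ∈ Set.uIcc 0 (2 * π), HasDerivAt
      (fun θ : ℝ => g (θ * Complex.I) * Complex.exp (-(n : ℂ) * (θ * Complex.I)))
      (Complex.I * (g' (θ * Complex.I) * Complex.exp (-(n : ℂ) * (θ * Complex.I)) -
        n * (g (θ * Complex.I) * Complex.exp (-(n : ℂ) * (θ * Complex.I))))) θ := by
    intro θ _
    have h1 : HasDerivAt (fun θ : ℝ => (θ : ℂ) * Complex.I) Complex.I θ := by
      simpa using (hasDerivAt_id θ).ofReal_comp.mul_const Complex.I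
    have h2 : HasDerivAt (fun θ : ℝ => g (θ * Complex.I)) (g' (θ * Complex.I) * Complex.I) θ :=
      (hg _).comp_of_eq θ h1 rfl
    refine (h2.mul (h1.const_mul (-(n : ℂ))).cexp).congr_deriv ?_
    ring
  have hint := ((intervalIntegrable_circCoeff hg' n).sub
    ((intervalIntegrable_circCoeff hgc n).const_mul (n : ℂ))).const_mul Complex.I
  have h := intervalIntegral.integral_eq_sub_of_hasDerivAt hder hint
  have h0 : g ((2 * π : ℝ) * Complex.I) = g 0 := by
    rw [← hper 0]; congr 1; push_cast; ring
  have he : Complex.exp (-(n : ℂ) * ((2 * π : ℝ) * Complex.I)) = 1 := by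
    have := Complex.exp_int_mul_two_pi_mul_I (-n)
    push_cast at this ⊢
    exact this
  rw [h0, he, intervalIntegral.integral_const_mul,
    intervalIntegral.integral_sub (intervalIntegrable_circCoeff hg' n)
      ((intervalIntegrable_circCoeff hgc n).const_mul (n : ℂ)),
    intervalIntegral.integral_const_mul] at h
  simp only [Complex.ofReal_zero, zero_mul, mul_zero, Complex.exp_zero, mul_one, sub_self,
    mul_eq_zero, Complex.I_ne_zero, false_or] at h
  rw [circCoeff, circCoeff]
  linear_combination (1 / (2 * π) : ℂ) * h

theorem circCoeff_one (n : ℤ) : circCoeff (fun _ => 1) n = if n = 0 then 1 else 0 := by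
  split_ifs with hn
  · subst hn
    have : (π : ℂ) ≠ 0 := by exact_mod_cast Real.pi_ne_zero
    simp [circCoeff]
    field_simp
  · have h := circCoeff_deriv (g := fun _ => (1 : ℂ)) (g' := fun _ => 0)
      (fun ξ => hasDerivAt_const ξ 1) continuous_const (fun _ => rfl) n
    have h0 : circCoeff (fun _ => 0) n = 0 := by simp [circCoeff]
    rw [h0] at h
    exact (mul_eq_zero.1 h.symm).resolve_left (by exact_mod_cast hn)

theorem memℓp_circCoeff {g : ℂ → ℂ} (hg : Continuous g) : Memℓp (circCoeff g) 2 := by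
  have hgc : Continuous fun θ : ℝ => g (θ * Complex.I) := hg.comp (by fun_prop)
  have hL2 : MemLp (fun θ : ℝ => g (θ * Complex.I)) 2
      (volume.restrict (Set.Ioc 0 (2 * π))) := by
    obtain ⟨C, hC⟩ := isCompact_Icc.exists_bound_of_continuousOn
      (s := Set.Icc (0 : ℝ) (2 * π)) hgc.continuousOn
    refine MemLp.of_bound hgc.aestronglyMeasurable C ?_
    filter_upwards [ae_restrict_mem measurableSet_Ioc] with θ hθ
    exact hC θ (Set.Ioc_subset_Icc_self hθ)
  have h := (hasSum_sq_fourierCoeffOn Real.two_pi_pos hL2).summable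
  have heq : ∀ n, fourierCoeffOn Real.two_pi_pos (fun θ : ℝ => g (θ * Complex.I)) n =
      circCoeff g n := by
    intro n
    rw [fourierCoeffOn_eq_integral, circCoeff, Complex.real_smul]
    push_cast
    rw [sub_zero]
    congr 2
    ext θ
    rw [fourier_coe_apply, smul_eq_mul, mul_comm]
    congr 2
    have : (π : ℂ) ≠ 0 := by exact_mod_cast Real.pi_ne_zero
    push_cast
    field_simp
    ring
  refine memℓp_gen ?_
  simpa [heq] using h

/-- The Fourier coefficients of a periodic entire function can be computed on any circle. -/
theorem circCoeff_eq_shift {g : ℂ → ℂ} (hg : Differentiable ℂ g)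
    (hper : ∀ ξ, g (ξ + 2 * π * Complex.I) = g ξ) (n : ℤ) (s : ℝ) :
    circCoeff g n = (1 / (2 * π)) * ∫ θ in (0 : ℝ)..2 * π,
      g (s + θ * Complex.I) * Complex.exp (-(n : ℂ) * (s + θ * Complex.I)) := by
  have hf : Differentiable ℂ fun ξ : ℂ => g ξ * Complex.exp (-(n : ℂ) * ξ) :=
    hg.mul (by fun_prop)
  -- Cauchy's theorem on the rectangle with corners `s` and `2πi`; the horizontal sides cancel by
  -- periodicity.
  have h := Complex.integral_boundary_rect_eq_zero_of_differentiableOn _ (s : ℂ)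
    (2 * π * Complex.I) hf.differentiableOn
  have hre : (2 * π * Complex.I : ℂ).re = 0 := by simp
  have him : (2 * π * Complex.I : ℂ).im = 2 * π := by simp
  have hp : ∀ ξ : ℂ, g (ξ + 2 * π * Complex.I) *
      Complex.exp (-(n : ℂ) * (ξ + 2 * π * Complex.I)) = g ξ * Complex.exp (-(n : ℂ) * ξ) := by
    intro ξ
    have := Complex.exp_int_mul_two_pi_mul_I (-n)
    push_cast at this
    rw [hper, mul_add, Complex.exp_add, this, mul_one]
  rw [hre, him] at h
  simp only [Complex.ofReal_im, Complex.ofReal_re, Complex.ofReal_zero, zero_mul, add_zero,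
    Complex.ofReal_mul, Complex.ofReal_ofNat, hp, sub_self, zero_add, smul_eq_mul] at h
  rw [← mul_sub, mul_eq_zero, or_iff_right Complex.I_ne_zero] at h
  rw [circCoeff]
  congr 1
  exact sub_eq_zero.1 h

/-- Removable singularity: on the circle `|z| = e^s` the coefficient is at most `C e^{-ns}`, which
tends to `0` as `s → -∞` when `n < 0`. -/
theorem circCoeff_eq_zero_of_bounded {g : ℂ → ℂ} (hg : Differentiable ℂ g)
    (hper : ∀ ξ, g (ξ + 2 * π * Complex.I) = g ξ) {s₀ C : ℝ}
    (hC : ∀ ξ : ℂ, ξ.re ≤ s₀ → ‖g ξ‖ ≤ C) {n : ℤ} (hn : n < 0) : circCoeff g n = 0 := by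
  have hn' : 0 < -(n : ℝ) := by exact_mod_cast neg_pos.2 hn
  have hle : ∀ s : ℝ, s ≤ s₀ → ‖circCoeff g n‖ ≤ C * Real.exp (-(n : ℝ) * s) := by
    intro s hs
    rw [circCoeff_eq_shift hg hper n s, norm_mul]
    have h := intervalIntegral.norm_integral_le_of_norm_le_const (a := 0) (b := 2 * π)
      (C := C * Real.exp (-(n : ℝ) * s)) (f := fun θ : ℝ =>
        g (s + θ * Complex.I) * Complex.exp (-(n : ℂ) * (s + θ * Complex.I))) (fun θ _ => by
        rw [norm_mul, Complex.norm_exp]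
        have h1 := hC (s + θ * Complex.I) (by simpa using hs)
        have h2 : (-(n : ℂ) * (s + θ * Complex.I)).re = -(n : ℝ) * s := by simp
        rw [h2]
        gcongr)
    rw [sub_zero, abs_of_pos Real.two_pi_pos] at h
    have h3 : ‖(1 / (2 * π) : ℂ)‖ = 1 / (2 * π) := by
      rw [show (1 / (2 * π) : ℂ) = ((1 / (2 * π) : ℝ) : ℂ) by push_cast; rfl, Complex.norm_real,
        Real.norm_of_nonneg (by positivity)]
    rw [h3]
    calc _ ≤ 1 / (2 * π) * (C * Real.exp (-(n : ℝ) * s) * (2 * π)) := by gcongr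
      _ = _ := by field_simp
  have hlim : Tendsto (fun s : ℝ => C * Real.exp (-(n : ℝ) * s)) atBot (𝓝 0) := by
    have := (Real.tendsto_exp_atBot.comp (tendsto_id.const_mul_atBot hn')).const_mul C
    simpa using this
  have h0 : ‖circCoeff g n‖ ≤ 0 := by
    refine ge_of_tendsto hlim ?_
    filter_upwards [eventually_le_atBot s₀] with s hs using hle s hs
  exact norm_le_zero_iff.1 h0

/-! ### From admissible primitives back to eigenvectors -/

section

variable {N : ℕ} {c : ℤ → ℂ} {ε lam : ℝ} {b : Fin N → ℂ} {F : ℂ → ℂ}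

theorem continuous_laurent (N : ℕ) (d : ℤ → ℂ) : Continuous (laurent N d) := by
  unfold laurent; fun_prop

theorem continuous_negPart (N : ℕ) (b : Fin N → ℂ) : Continuous (negPart N b) := by
  unfold negPart; fun_prop

theorem circCoeff_laurent_mul (N : ℕ) (c : ℤ → ℂ) {g : ℂ → ℂ} (hg : Continuous g) (n : ℤ) :
    circCoeff (fun ξ => laurent N c ξ * g ξ) n =
      ∑ k ∈ Finset.Icc (-(N : ℤ)) (N : ℤ), c k * circCoeff g (n - k) := by
  simp only [laurent, Finset.sum_mul]
  rw [circCoeff_sum _ fun k _ => by fun_prop]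
  refine Finset.sum_congr rfl fun k _ => ?_
  simp only [mul_assoc]
  rw [circCoeff_const_mul, circCoeff_exp_mul]

theorem circCoeff_negPart (b : Fin N → ℂ) (n : ℤ) :
    circCoeff (negPart N b) n = ∑ j : Fin N, if n = -((j : ℕ) + 1 : ℤ) then b j else 0 := by
  unfold negPart
  rw [circCoeff_sum _ fun j _ => by fun_prop]
  refine Finset.sum_congr rfl fun j _ => ?_
  have h := circCoeff_exp_mul (-((j : ℕ) + 1 : ℤ)) (fun _ => 1) n
  rw [circCoeff_one] at h
  push_cast [mul_one] at h
  rw [circCoeff_const_mul, h]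
  simp only [sub_eq_zero]
  split_ifs <;> simp_all

/-- Fourier coefficients of the differential equation satisfied by the quotient. The first identity
shows that `n a_n` is square summable; in the second, the source term in `b` lives on negative
frequencies only. -/
theorem IsAdmissible.circCoeff_quot (hc : IsPotential N c) (hε : 0 < ε)
    (hF : IsAdmissible N c ε lam b F Set.univ) (n : ℤ) :
    n * circCoeff (quot N c ε lam F) n =
      circCoeff (fun ξ => negPart N b ξ + (laurent N c ξ + lam) / ε * quot N c ε lam F ξ) n ∧
    ε * n * circCoeff (quot N c ε lam F) n -
      ∑ k ∈ Finset.Icc (-(N : ℤ)) (N : ℤ), c k * circCoeff (quot N c ε lam F) (n - k) =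
        lam * circCoeff (quot N c ε lam F) n +
          ε * ∑ j : Fin N, if n = -((j : ℕ) + 1 : ℤ) then b j else 0 := by
  have hεC : (ε : ℂ) ≠ 0 := by exact_mod_cast hε.ne'
  have hw : Continuous (quot N c ε lam F) :=
    continuous_iff_continuousAt.2 fun ξ => (hF.hasDerivAt_quot hc hε ξ).continuousAt
  have hl := continuous_laurent N c
  have hb := continuous_negPart N b
  have h1 := circCoeff_deriv (hF.hasDerivAt_quot hc hε) (by fun_prop) (hF.quot_add_two_pi hc) n
  refine ⟨h1.symm, ?_⟩
  have h2 : (fun ξ => negPart N b ξ + (laurent N c ξ + lam) / ε * quot N c ε lam F ξ) =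
      fun ξ => negPart N b ξ + (1 / ε) * (laurent N c ξ * quot N c ε lam F ξ +
        lam * quot N c ε lam F ξ) := by
    ext ξ; ring
  rw [h2, circCoeff_add hb (by fun_prop), circCoeff_const_mul,
    circCoeff_add (by fun_prop) (by fun_prop), circCoeff_const_mul, circCoeff_laurent_mul N c hw,
    circCoeff_negPart] at h1
  field_simp at h1
  linear_combination -h1

theorem IsAdmissible.isEigenSeq (hc : IsPotential N c) (hε : 0 < ε)
    (hF : IsAdmissible N c ε lam b F Set.univ) (hb : b ≠ 0) :
    IsEigenSeq N c ε lam (circCoeff (quot N c ε lam F)) := by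
  have hεC : (ε : ℂ) ≠ 0 := by exact_mod_cast hε.ne'
  have hw : Continuous (quot N c ε lam F) :=
    continuous_iff_continuousAt.2 fun ξ => (hF.hasDerivAt_quot hc hε ξ).continuousAt
  have hl := continuous_laurent N c
  have hbc := continuous_negPart N b
  refine ⟨fun h => hb ?_, fun n hn => ?_, memℓp_circCoeff hw, ?_, fun n hn => ?_⟩
  -- If all coefficients vanished, the recurrence at the frequency `-(j + 1)` would reduce to `ε b_j
  -- = 0`.
  · ext j
    have h1 := (hF.circCoeff_quot hc hε (-((j : ℕ) + 1 : ℤ))).2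
    simp only [h, Pi.zero_apply, mul_zero, Finset.sum_const_zero, sub_zero, zero_add] at h1
    have h2 := (mul_eq_zero.1 h1.symm).resolve_left hεC
    rw [Finset.sum_eq_single_of_mem j (Finset.mem_univ j)] at h2
    · simpa using h2
    · intro i _ hij
      rw [if_neg]
      intro h3
      exact hij (Fin.ext (by omega))
  · obtain ⟨s₀, C, hC⟩ := hF.exists_norm_quot_le hc hε
    exact circCoeff_eq_zero_of_bounded
      (fun ξ => (hF.hasDerivAt_quot hc hε ξ).differentiableAt) (hF.quot_add_two_pi hc) hC hn
  · simp only [(hF.circCoeff_quot hc hε _).1]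
    exact memℓp_circCoeff (by fun_prop)
  · rw [(hF.circCoeff_quot hc hε n).2, Finset.sum_eq_zero, mul_zero, add_zero]
    intro j _
    rw [if_neg (by omega)]

end

end

end LaxEvans

/-! ### The eigenvalue equation -/

theorem theorem2p3 (N : ℕ) (hN : 1 ≤ N) (c : ℤ → ℂ) (u : C(LaxEvans.Torus, ℝ))
    (hu : ∀ x : LaxEvans.Torus,
      (u x : ℂ) = ∑ k ∈ Finset.Icc (-(N : ℤ)) (N : ℤ), c k * fourier k x)
    (hmean : ∫ x, u x ∂(haarAddCircle : Measure LaxEvans.Torus) = 0)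
    (hcN_re : 0 < (c N).re) (hcN_im : (c N).im = 0)
    (ε : ℝ) (hε : 0 < ε) (lam : ℝ) :
    LaxEvans.IntegralsConverge N c ε lam ∧
      (LaxEvans.IsEigenvalue (LaxEvans.laxOperator u ε) (lam : ℂ) ↔
        (LaxEvans.matrixA N c ε lam).det = 0) := by
  have hc : LaxEvans.IsPotential N c :=
    { one_le := hN
      zero := LaxEvans.coeff_zero hu hmean
      conj_eq := fun k hk => by
        rw [Finset.mem_Icc] at hk
        exact LaxEvans.conj_coeff hu (Finset.mem_Icc.2 (by omega))
      re_pos := hcN_re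
      im_eq := hcN_im }
  refine ⟨LaxEvans.integralsConverge hc hε lam, ?_⟩
  rw [LaxEvans.isEigenvalue_iff_exists_isEigenSeq hu]
  constructor
  · rintro ⟨a, ha⟩
    exact LaxEvans.det_eq_zero_of_isAdmissible hc hε (ha.tailCoeff_ne_zero hc)
      (ha.exists_isAdmissible hc hε)
  · intro hdet
    obtain ⟨b, F, hb, hF⟩ := LaxEvans.exists_isAdmissible_of_det_eq_zero hc hε hdet
    exact ⟨_, hF.isEigenSeq hc hε hb⟩
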